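/- Let $\mathbb F=\mathbb R$ or $\mathbb C$. Consider one independent variable $x\in\mathbb R$ and one dependent variable with jet coordinates $u_0,u_1,u_2,\dots\in\mathbb R$, and let $U\subseteq\mathbb R^{\mathbb Z_+}$ be open (in the product topology). Let $\mathcal F$ be the algebra of smooth $\mathbb F$-valued functions on $\mathbb R\times U$ that depend on finitely many of the arguments $x,u_0,u_1,\dots$; put $D=\partial_x+\sum_i u_{i+1}\partial_{u_i}$ and $\delta K=\sum_i(-D)^i\partial_{u_i}K$, and write $\int K$ for the class of $K$ in $\mathcal F/D\mathcal F$. An operator $\Lambda(D)$ is called Hamiltonian if the bracket $\{\int K,\int L\}=\int\delta K\cdot\Lambda(D)\,\delta L$ on $\mathcal F/D\mathcal F$ is skew-symmetric and satisfies the Jacobi identity. Theorem (cf. [GD],[DN]). Let $\lambda=\lambda(u_0,\dots,u_n)\in\mathcal F$ (for some $n$) be independent of $x$. The operator $\Lambda(D)=\lambda D+\tfrac12 D\lambda$ (that is, $f\mapsto\lambda\cdot Df+\tfrac12(D\lambda)\cdot f$) is Hamiltonian if and only if on every convex open set $V\subseteq U$ on which neither $\lambda$ nor $u_1$ has a zero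 one has $$\lambda=\pm(\varphi u_2+\psi)^{-2}$$ with one choice of the sign on $V$, where $\varphi u_2+\psi$ has no zero on $V$ and $$\varphi=\chi_v(u,v)\big|_{u=u_0,\ v=u_1^2/2},\qquad \psi=\chi_u(u,v)\big|_{u=u_0,\ v=u_1^2/2}$$ for some smooth $\mathbb F$-valued function $\chi(u,v)$ on the open set $\{(u_0,u_1^2/2)\mid (u_0,u_1,u_2,\dots)\in V\}\subseteq\mathbb R^2$. (In particular, if $U$ itself is convex and $\lambda$ and $u_1$ have no zeros on $U$, then $\Lambda(D)$ is Hamiltonian if and only if $\lambda=\pm(\varphi u_2+\psi)^{-2}$ on $U$ for some such $\chi$; the sign is $+$ if $\lambda>0$.) -/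

import Mathlib

open scoped ContDiff

noncomputable section

namespace JetCalculus

/-- A point `(x, (u₀, u₁, u₂, …))` of the infinite jet space of one dependent variable `u`
over one real independent variable `x` (with the product topology). -/
abbrev Jet : Type := ℝ × (ℕ → ℝ)

/-- The projection `(x, u₀, u₁, …) ↦ (x, u₀, …, u_{n-1})`. -/
def proj (n : ℕ) (p : Jet) : ℝ × (Fin n → ℝ) := (p.1, fun i => p.2 i)

variable {𝕜 : Type*} [RCLike 𝕜]

/-- The algebra `𝓕(Ω)` of smooth `𝕜`-valued functions on the open set `Ω` of the jet space that
depend on finitely many of the arguments `x, u₀, u₁, …`. Elements are represented by functions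
on the whole jet space, of which only the values on `Ω` matter. -/
def IsSmoothFin (Ω : Set Jet) (K : Jet → 𝕜) : Prop :=
  ∃ (n : ℕ) (F : ℝ × (Fin n → ℝ) → 𝕜),
    ContDiffOn ℝ ∞ F (proj n '' Ω) ∧ ∀ p ∈ Ω, K p = F (proj n p)

/-- The partial derivative `∂/∂x`. -/
def partialX (K : Jet → 𝕜) : Jet → 𝕜 := fun p =>
  deriv (fun t : ℝ => K (t, p.2)) p.1

/-- The partial derivative `∂/∂uᵢ`. -/
def partialU (i : ℕ) (K : Jet → 𝕜) : Jet → 𝕜 := fun p =>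
  deriv (fun t : ℝ => K (p.1, Function.update p.2 i t)) (p.2 i)

/-- The total derivative `D = ∂/∂x + ∑ᵢ uᵢ₊₁ ∂/∂uᵢ` (on `Ω`, for `K` in `𝓕(Ω)`, all but finitely
many terms of the sum vanish). -/
def totalD (K : Jet → 𝕜) : Jet → 𝕜 := fun p =>
  partialX K p + ∑ᶠ i : ℕ, (p.2 (i + 1)) • partialU i K p

/-- The variational derivative `δK = ∑ᵢ (-D)ⁱ (∂K/∂uᵢ)`. -/
def varDeriv (K : Jet → 𝕜) : Jet → 𝕜 := fun p =>
  ∑ᶠ i : ℕ, (-1 : 𝕜) ^ i * (totalD^[i] (partialU i K)) p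

/-- `K` represents the zero functional: `∫ K = 0` in `𝓕(Ω) / D 𝓕(Ω)`. -/
def IsNullFunctional (Ω : Set Jet) (K : Jet → 𝕜) : Prop :=
  ∃ B : Jet → 𝕜, IsSmoothFin Ω B ∧ ∀ p ∈ Ω, K p = totalD B p

/-- The density `δK · Λ(δL)` of the bracket `{∫ K, ∫ L} = ∫ δK · Λ(δL)` of the operator `Λ`. -/
def bracket (Λ : (Jet → 𝕜) → (Jet → 𝕜)) (K L : Jet → 𝕜) : Jet → 𝕜 :=
  varDeriv K * Λ (varDeriv L)

/-- The operator `Λ` is Hamiltonian over `𝓕(Ω)`: its bracket is skew-symmetric and satisfies the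
Jacobi identity on the space of functionals `𝓕(Ω) / D 𝓕(Ω)`. (The bracket depends only on the
functionals and not on the densities, as `δ` vanishes on `D 𝓕(Ω)`.) -/
def IsHamiltonian (Ω : Set Jet) (Λ : (Jet → 𝕜) → (Jet → 𝕜)) : Prop :=
  (∀ K L : Jet → 𝕜, IsSmoothFin Ω K → IsSmoothFin Ω L →
    IsNullFunctional Ω (bracket Λ K L + bracket Λ L K)) ∧
  (∀ K L M : Jet → 𝕜, IsSmoothFin Ω K → IsSmoothFin Ω L → IsSmoothFin Ω M →
    IsNullFunctional Ω
      (bracket Λ K (bracket Λ L M) + bracket Λ L (bracket Λ M K) + bracket Λ M (bracket Λ K L)))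

/-- The operator `Λ(D) = a D + ½ (D a)`, that is `f ↦ a · D f + ½ (D a) · f`. -/
def firstOrderOp (a : Jet → 𝕜) : (Jet → 𝕜) → (Jet → 𝕜) := fun f =>
  a * totalD f + (fun p => (1 / 2 : 𝕜) * totalD a p * f p)

/-- The open set `ℝ × U` of jets `(x, u₀, u₁, …)` with `(u₀, u₁, …) ∈ U`. -/
def jetDomain (U : Set (ℕ → ℝ)) : Set Jet := {p | p.2 ∈ U}

/-- A function `a(u₀, u₁, …)` regarded as a function on the jet space. -/
def liftU (a : (ℕ → ℝ) → 𝕜) : Jet → 𝕜 := fun p => a p.2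

/-- `φ = ∂χ/∂v` at `u = u₀`, `v = u₁² / 2`. -/
def phi (χ : ℝ × ℝ → 𝕜) (u : ℕ → ℝ) : 𝕜 :=
  deriv (fun v : ℝ => χ (u 0, v)) (u 1 ^ 2 / 2)

/-- `ψ = ∂χ/∂u` at `u = u₀`, `v = u₁² / 2`. -/
def psi (χ : ℝ × ℝ → 𝕜) (u : ℕ → ℝ) : 𝕜 :=
  deriv (fun s : ℝ => χ (s, u 1 ^ 2 / 2)) (u 0)

/-- On `V`, the function `a` is `± (φ u₂ + ψ)⁻²`, where `φ`, `ψ` come from one function `χ(u, v)`,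
smooth on the set of all values `(u₀, u₁² / 2)` over `V`, and one choice of the sign. -/
def HasPotentialForm (V : Set (ℕ → ℝ)) (a : (ℕ → ℝ) → 𝕜) : Prop :=
  ∃ (χ : ℝ × ℝ → 𝕜) (ε : 𝕜), (ε = 1 ∨ ε = -1) ∧
    ContDiffOn ℝ ∞ χ ((fun u : ℕ → ℝ => (u 0, u 1 ^ 2 / 2)) '' V) ∧
    ∀ u ∈ V, phi χ u * ((u 2 : ℝ) : 𝕜) + psi χ u ≠ 0 ∧
      a u = ε * (phi χ u * ((u 2 : ℝ) : 𝕜) + psi χ u) ^ (-2 : ℤ)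

end JetCalculus

end

/-! Write `l` for λ, `l_i` for its partial derivatives, and a prime for the total derivative `D`.
Since `f·Λg + g·Λf = D(l f g)`, skew-symmetry is automatic and only the Jacobi identity matters.

The variational derivative of `g·Λh` contains the Fréchet derivatives of `g`, `h` and `l`. Those of
variational derivatives are self-adjoint, so the ones of `f`, `g`, `h` cancel in the cyclic sum
modulo total derivatives. What remains is that the cyclic sum `tri` of `(g h' - g' h)·l_*(Λf)` be a
total derivative for all `f = δK`, `g = δL`, `h = δM` (`jacobi_iff`).

Necessity: modulo total derivatives `tri` equals `f·cof(g, h)`. Functionals built from powers of `x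
- x₀` and from `u₀` make `f` general enough to force `cof = 0` when `g`, `h` are powers of `x - x₀`.
Evaluation at `x₀` then shows that `l` has order at most 2 and that `obs = l_1 l + (3/2) l_2 l' - l
(l_2)'` vanishes. Sufficiency: if the order is at most 2 and `obs = 0`, then `tri` is an explicit
total derivative (`jacobi_of_obs_eq_zero`).

On a convex set without zeros of `l` one can write `l = ±r⁻²` with `r` smooth, and `obs` becomes a
nonvanishing multiple of `D(r_2) - r_1`. The coefficient of `u₃` in `D(r_2) = r_1` says that `r = φ
u₂ + ψ` with `φ`, `ψ` functions of `u₀, u₁`; the rest says `∂ψ/∂u₁ = u₁ ∂φ/∂u₀`. Thus `ψ du₀ + φ u₁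
du₁` is closed, and with `v = u₁²/2` it is `dχ`.

Zeros of `l` and of `u₁` are harmless: the ring of functions is reduced, so an identity known after
multiplication by `u₁ l` can be differentiated to recover the identity itself
(`jacobi_of_mul_eq_zero`). -/

noncomputable section

namespace JetCalculus

/-! ### Formal variational calculus in a differential ring; reduction of the Jacobi identity to
`tri`. -/

section

/-- A differential ring with a total derivative `D` and commuting, locally finite partial
derivatives `d i` that satisfy the commutation relations of the jet calculus. -/
structure JetDer (A : Type*) [CommRing A] where
  /-- the total derivative -/
  D : Derivation ℤ A A
  /-- the partial derivatives -/
  d : ℕ → Derivation ℤ A A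
  d_comm : ∀ i j a, d i (d j a) = d j (d i a)
  d_zero_D : ∀ a, d 0 (D a) = D (d 0 a)
  d_succ_D : ∀ i a, d (i + 1) (D a) = D (d (i + 1) a) + d i a
  finite : ∀ a, ∃ n, ∀ i ≥ n, d i a = 0

namespace JetDer

open Finset

variable {A : Type*} [CommRing A] (J : JetDer A)

/-- `D` as an additive endomorphism. -/
def T : Module.End ℤ A := (J.D : A →ₗ[ℤ] A)

/-- `-D` as an additive endomorphism. -/
def E : Module.End ℤ A := -J.T

@[simp] lemma T_apply (a : A) : J.T a = J.D a := rfl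

@[simp] lemma E_apply (a : A) : J.E a = -J.D a := rfl

lemma E_pow_apply (i : ℕ) (a : A) : (J.E ^ i) a = (-1) ^ i * (J.T ^ i) a := by
  rw [E, neg_pow]
  rcases Nat.even_or_odd i with h | h <;> simp [h.neg_one_pow]

/-- A bound for the order of `a`. -/
def ord (a : A) : ℕ := (J.finite a).choose

lemma d_of_ord_le {a : A} {i : ℕ} (h : J.ord a ≤ i) : J.d i a = 0 := (J.finite a).choose_spec i h

/-- The Fréchet derivative `w ↦ ∑ᵢ ∂ᵢa Dⁱw`. -/
def fre (a : A) : Module.End ℤ A :=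
  ∑ i ∈ range (J.ord a), LinearMap.mulLeft ℤ (J.d i a) * J.T ^ i

/-- The adjoint `w ↦ ∑ᵢ (-D)ⁱ (∂ᵢa w)` of the Fréchet derivative. -/
def adj (a : A) : Module.End ℤ A :=
  ∑ i ∈ range (J.ord a), J.E ^ i * LinearMap.mulLeft ℤ (J.d i a)

/-- The variational derivative. -/
def δ (a : A) : A := J.adj a 1

lemma sum_range_eq_of_vanish {M : Type*} [AddCommMonoid M] {f : ℕ → M} {m n : ℕ}
    (hm : ∀ i ≥ m, f i = 0) (hn : ∀ i ≥ n, f i = 0) :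
    ∑ i ∈ range m, f i = ∑ i ∈ range n, f i := by
  rcases le_total m n with h | h
  · exact sum_subset (range_subset_range.2 h) fun i _ hi => hm i (by simpa using hi)
  · exact (sum_subset (range_subset_range.2 h) fun i _ hi => hn i (by simpa using hi)).symm

lemma fre_apply {a : A} {n : ℕ} (h : ∀ i ≥ n, J.d i a = 0) (w : A) :
    J.fre a w = ∑ i ∈ range n, J.d i a * (J.T ^ i) w := by
  simp only [fre, LinearMap.sum_apply, Module.End.mul_apply, LinearMap.mulLeft_apply]
  exact sum_range_eq_of_vanish (fun i hi => by simp [J.d_of_ord_le hi])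
    (fun i hi => by simp [h i hi])

lemma adj_apply {a : A} {n : ℕ} (h : ∀ i ≥ n, J.d i a = 0) (w : A) :
    J.adj a w = ∑ i ∈ range n, (J.E ^ i) (J.d i a * w) := by
  simp only [adj, LinearMap.sum_apply, Module.End.mul_apply, LinearMap.mulLeft_apply]
  exact sum_range_eq_of_vanish (fun i hi => by simp [J.d_of_ord_le hi])
    (fun i hi => by simp [h i hi])

lemma exists_common_bound (a b : A) : ∃ n, (∀ i ≥ n, J.d i a = 0) ∧ ∀ i ≥ n, J.d i b = 0 := by
  obtain ⟨m, hm⟩ := J.finite a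
  obtain ⟨n, hn⟩ := J.finite b
  exact ⟨max m n, fun i hi => hm i (le_trans (le_max_left _ _) hi),
    fun i hi => hn i (le_trans (le_max_right _ _) hi)⟩

lemma fre_add (a b w : A) : J.fre (a + b) w = J.fre a w + J.fre b w := by
  obtain ⟨n, ha, hb⟩ := J.exists_common_bound a b
  rw [J.fre_apply ha, J.fre_apply hb, J.fre_apply (n := n) fun i hi => by
    simp [ha i hi, hb i hi], ← sum_add_distrib]
  simp [add_mul]

lemma adj_add (a b w : A) : J.adj (a + b) w = J.adj a w + J.adj b w := by
  obtain ⟨n, ha, hb⟩ := J.exists_common_bound a b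
  rw [J.adj_apply ha, J.adj_apply hb, J.adj_apply (n := n) fun i hi => by
    simp [ha i hi, hb i hi], ← sum_add_distrib]
  simp [add_mul]

lemma fre_zero (w : A) : J.fre 0 w = 0 := by
  simp [J.fre_apply (a := 0) (n := 0) (fun i _ => map_zero _)]

lemma adj_zero (w : A) : J.adj 0 w = 0 := by
  simp [J.adj_apply (a := 0) (n := 0) (fun i _ => map_zero _)]

lemma adj_neg (a w : A) : J.adj (-a) w = -J.adj a w := by
  rw [eq_neg_iff_add_eq_zero, ← adj_add, neg_add_cancel, adj_zero]

lemma fre_neg (a w : A) : J.fre (-a) w = -J.fre a w := by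
  rw [eq_neg_iff_add_eq_zero, ← fre_add, neg_add_cancel, fre_zero]

lemma adj_sub (a b w : A) : J.adj (a - b) w = J.adj a w - J.adj b w := by
  rw [sub_eq_add_neg, adj_add, adj_neg, sub_eq_add_neg]

lemma fre_sum {ι : Type*} (s : Finset ι) (f : ι → A) (w : A) :
    J.fre (∑ i ∈ s, f i) w = ∑ i ∈ s, J.fre (f i) w := by
  classical
  induction s using Finset.induction_on with
  | empty => simp [fre_zero]
  | insert a s ha ih => rw [sum_insert ha, sum_insert ha, fre_add, ih]

lemma adj_sum {ι : Type*} (s : Finset ι) (f : ι → A) (w : A) :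
    J.adj (∑ i ∈ s, f i) w = ∑ i ∈ s, J.adj (f i) w := by
  classical
  induction s using Finset.induction_on with
  | empty => simp [adj_zero]
  | insert a s ha ih => rw [sum_insert ha, sum_insert ha, adj_add, ih]

lemma adj_mul (a b w : A) : J.adj (a * b) w = J.adj a (b * w) + J.adj b (a * w) := by
  obtain ⟨n, ha, hb⟩ := J.exists_common_bound a b
  rw [J.adj_apply ha, J.adj_apply hb, J.adj_apply (n := n) fun i hi => by
    simp [ha i hi, hb i hi], ← sum_add_distrib]
  refine sum_congr rfl fun i _ => ?_
  rw [← map_add, Derivation.leibniz]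
  congr 1
  simp only [smul_eq_mul]
  ring

lemma d_D_of_bound {a : A} {n : ℕ} (h : ∀ i ≥ n, J.d i a = 0) :
    ∀ i ≥ n + 1, J.d i (J.D a) = 0 := by
  intro i hi
  obtain ⟨j, rfl⟩ := Nat.exists_eq_add_of_le' (show 1 ≤ i by omega)
  rw [J.d_succ_D, h (j + 1) (by omega), h j (by omega)]
  simp

lemma fre_D (a w : A) : J.fre (J.D a) w = J.D (J.fre a w) := by
  obtain ⟨n, ha⟩ := J.finite a
  rw [J.fre_apply ha, J.fre_apply (J.d_D_of_bound ha), sum_range_succ', map_sum]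
  simp only [J.d_succ_D, J.d_zero_D, add_mul, Derivation.leibniz, smul_eq_mul, sum_add_distrib]
  have h1 : ∑ i ∈ range n, J.D (J.d (i + 1) a) * (J.T ^ (i + 1)) w
      + J.D (J.d 0 a) * (J.T ^ 0) w = ∑ i ∈ range n, (J.T ^ i) w * J.D (J.d i a) := by
    rw [← sum_range_succ' (fun i => J.D (J.d i a) * (J.T ^ i) w), sum_range_succ, ha n le_rfl]
    simp [mul_comm]
  rw [add_right_comm, h1, add_comm]
  congr 1
  refine sum_congr rfl fun i _ => ?_
  rw [pow_succ', Module.End.mul_apply, T_apply]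

lemma adj_D (a w : A) : J.adj (J.D a) w = -J.adj a (J.D w) := by
  obtain ⟨n, ha⟩ := J.finite a
  rw [J.adj_apply ha, J.adj_apply (J.d_D_of_bound ha), sum_range_succ']
  simp only [J.d_succ_D, J.d_zero_D, add_mul, map_add, sum_add_distrib]
  have h1 : ∑ i ∈ range n, (J.E ^ (i + 1)) (J.D (J.d (i + 1) a) * w)
      + (J.E ^ 0) (J.D (J.d 0 a) * w) = ∑ i ∈ range n, (J.E ^ i) (J.D (J.d i a) * w) := by
    rw [← sum_range_succ' (fun i => (J.E ^ i) (J.D (J.d i a) * w)), sum_range_succ, ha n le_rfl]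
    simp
  rw [add_right_comm, h1, ← sum_add_distrib, ← sum_neg_distrib]
  refine sum_congr rfl fun i _ => ?_
  rw [pow_succ, Module.End.mul_apply, ← map_add, ← map_neg, E_apply, Derivation.leibniz]
  congr 1
  simp only [smul_eq_mul]
  ring

lemma fre_E_pow (i : ℕ) (a w : A) : J.fre ((J.E ^ i) a) w = (J.E ^ i) (J.fre a w) := by
  induction i with
  | zero => simp
  | succ i ih =>
    rw [pow_succ', Module.End.mul_apply, Module.End.mul_apply, E_apply, fre_neg, fre_D, ih,
      E_apply]

lemma adj_E_pow (i : ℕ) (a w : A) : J.adj ((J.E ^ i) a) w = J.adj a ((J.T ^ i) w) := by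
  induction i generalizing w with
  | zero => simp
  | succ i ih =>
    rw [pow_succ', Module.End.mul_apply, E_apply, adj_neg, adj_D, ih, neg_neg, pow_succ,
      Module.End.mul_apply, T_apply]

lemma δ_apply {a : A} {n : ℕ} (h : ∀ i ≥ n, J.d i a = 0) :
    J.δ a = ∑ i ∈ range n, (J.E ^ i) (J.d i a) := by
  simp [δ, J.adj_apply h]

lemma δ_D (a : A) : J.δ (J.D a) = 0 := by
  rw [δ, adj_D]; simp

lemma δ_add (a b : A) : J.δ (a + b) = J.δ a + J.δ b := J.adj_add a b 1

/-- The Fréchet derivative of a variational derivative is self-adjoint. -/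
lemma fre_δ (a w : A) : J.fre (J.δ a) w = J.adj (J.δ a) w := by
  obtain ⟨n, ha⟩ := J.finite a
  rw [J.δ_apply ha, fre_sum, adj_sum]
  simp only [fre_E_pow, adj_E_pow]
  have hb : ∀ i, ∀ j ≥ n, J.d j (J.d i a) = 0 := fun i j hj => by
    rw [J.d_comm, ha j hj, map_zero]
  simp only [J.fre_apply (hb _), J.adj_apply (hb _), map_sum]
  -- Both sides are double sums of `(-D)^i (∂ⱼ∂ᵢa · D^j w)`, differing by an exchange of `i` and
  -- `j`; commuting partial derivatives identify them.
  rw [sum_comm]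
  refine sum_congr rfl fun i _ => sum_congr rfl fun j _ => ?_
  rw [J.d_comm]

/-- The total derivatives. -/
def null : Submodule ℤ A := LinearMap.range J.T

lemma D_mem_null (a : A) : J.D a ∈ J.null := ⟨a, rfl⟩

lemma δ_of_mem_null {a : A} (h : a ∈ J.null) : J.δ a = 0 := by
  obtain ⟨b, rfl⟩ := h
  exact J.δ_D b

lemma mul_E_pow_sub_mem_null (i : ℕ) (x y : A) :
    x * (J.E ^ i) y - (J.T ^ i) x * y ∈ J.null := by
  induction i generalizing x with
  | zero => simp
  | succ i ih =>
    rw [pow_succ', Module.End.mul_apply, E_apply, pow_succ, Module.End.mul_apply, T_apply]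
    have h := J.null.sub_mem (ih (J.D x)) (J.D_mem_null (x * (J.E ^ i) y))
    convert h using 1
    simp only [Derivation.leibniz, smul_eq_mul]
    ring

lemma mul_adj_sub_mem_null (a v w : A) : v * J.adj a w - w * J.fre a v ∈ J.null := by
  obtain ⟨n, ha⟩ := J.finite a
  rw [J.adj_apply ha, J.fre_apply ha, mul_sum, mul_sum, ← sum_sub_distrib]
  refine J.null.sum_mem fun i _ => ?_
  convert J.mul_E_pow_sub_mem_null i v (J.d i a * w) using 1
  ring

/-- The Wronskian of two elements. -/
def wr (g h : A) : A := g * J.D h - J.D g * h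

/-- The operator `l D + ½ (D l)`, where `t` stands for `½`. -/
def op (t l w : A) : A := l * J.D w + t * J.D l * w

lemma D_eq_zero_of_half {t : A} (ht : t + t = 1) : J.D t = 0 := by
  have h : J.D t + J.D t = 0 := by rw [← map_add, ht]; simp
  calc J.D t = t * (J.D t + J.D t) := by linear_combination (-J.D t) * ht
    _ = 0 := by rw [h, mul_zero]

lemma d_eq_zero_of_half {t : A} (ht : t + t = 1) (i : ℕ) : J.d i t = 0 := by
  have h : J.d i t + J.d i t = 0 := by rw [← map_add, ht]; simp
  calc J.d i t = t * (J.d i t + J.d i t) := by linear_combination (-J.d i t) * ht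
    _ = 0 := by rw [h, mul_zero]

variable {J}

lemma mem_null_of_add_self {t a : A} (ht : t + t = 1) (h : a + a ∈ J.null) : a ∈ J.null := by
  obtain ⟨b, hb⟩ := h
  refine ⟨t * b, ?_⟩
  simp only [T_apply] at hb ⊢
  simp only [Derivation.leibniz, J.D_eq_zero_of_half ht, smul_eq_mul, hb]
  linear_combination a * ht

lemma mul_op_add_mem_null {t : A} (ht : t + t = 1) (l v w : A) :
    v * J.op t l w + w * J.op t l v ∈ J.null := by
  convert J.D_mem_null (l * v * w) using 1
  simp only [op, Derivation.leibniz, smul_eq_mul]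
  linear_combination (J.D l * v * w) * ht

variable (J) in
/-- `J.IsSelfAdj g`: the Fréchet derivative of `g` is self-adjoint. -/
def IsSelfAdj (g : A) : Prop := ∀ w, J.fre g w = J.adj g w

/-- Modulo a total derivative, `2 g·Λh` is `l·wr g h`. The product rule for `adj` gives one term
from `l` and one from the Wronskian; in the latter the adjoints become Fréchet derivatives by
self-adjointness. -/
lemma two_δ_mul_op {t : A} (ht : t + t = 1) (l : A) {g h : A} (hg : J.IsSelfAdj g)
    (hh : J.IsSelfAdj h) :
    J.δ (g * J.op t l h) + J.δ (g * J.op t l h) =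
      J.adj l (J.wr g h) + 2 * (J.fre g (J.op t l h) - J.fre h (J.op t l g)) := by
  have h1 : g * J.op t l h + g * J.op t l h = l * J.wr g h + J.D (l * (g * h)) := by
    simp only [op, wr, Derivation.leibniz, smul_eq_mul]
    linear_combination (J.D l * g * h) * ht
  have h2 : J.adj (J.wr g h) l = 2 * (J.adj g (J.op t l h) - J.adj h (J.op t l g)) := by
    rw [wr, adj_sub, adj_mul, adj_mul, adj_D, adj_D]
    have e1 : J.adj g (J.D h * l) + J.adj g (J.D (h * l)) = 2 * J.adj g (J.op t l h) := by
      rw [two_mul, ← map_add, ← map_add]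
      congr 1
      simp only [op, Derivation.leibniz, smul_eq_mul]
      linear_combination (-J.D l * h) * ht
    have e2 : J.adj h (J.D g * l) + J.adj h (J.D (g * l)) = 2 * J.adj h (J.op t l g) := by
      rw [two_mul, ← map_add, ← map_add]
      congr 1
      simp only [op, Derivation.leibniz, smul_eq_mul]
      linear_combination (-J.D l * g) * ht
    linear_combination e1 - e2
  rw [← δ_add, h1, δ_add, δ_D, δ, adj_mul, mul_one, mul_one, h2, hg, hh, add_zero]

variable (J) in
/-- The trilinear expression to which the Jacobi identity reduces. -/
def tri (t l f g h : A) : A :=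
  J.wr g h * J.fre l (J.op t l f) + J.wr h f * J.fre l (J.op t l g)
    + J.wr f g * J.fre l (J.op t l h)

lemma two_mul_op_δ_mem_null {t : A} (ht : t + t = 1) (l : A) {f g h : A}
    (hg : J.IsSelfAdj g) (hh : J.IsSelfAdj h) :
    f * J.op t l (J.δ (g * J.op t l h)) + f * J.op t l (J.δ (g * J.op t l h))
      + (J.wr g h * J.fre l (J.op t l f) + 2 * (J.op t l f * J.fre g (J.op t l h)
        - J.op t l f * J.fre h (J.op t l g))) ∈ J.null := by
  set w := J.δ (g * J.op t l h) with hw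
  have h1 := mul_op_add_mem_null (J := J) ht l f w
  have h2 := J.mul_adj_sub_mem_null l (J.op t l f) (J.wr g h)
  have h3 := two_δ_mul_op (J := J) ht l hg hh
  rw [← hw] at h3
  convert J.null.sub_mem (J.null.add_mem h1 h1) h2 using 1
  linear_combination -(J.op t l f) * h3

lemma jacobi_add_tri_mem_null {t : A} (ht : t + t = 1) (l : A) {f g h : A}
    (hf : J.IsSelfAdj f) (hg : J.IsSelfAdj g) (hh : J.IsSelfAdj h) :
    2 * (f * J.op t l (J.δ (g * J.op t l h)) + g * J.op t l (J.δ (h * J.op t l f))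
      + h * J.op t l (J.δ (f * J.op t l g))) + J.tri t l f g h ∈ J.null := by
  have h1 := two_mul_op_δ_mem_null (J := J) ht l (f := f) hg hh
  have h2 := two_mul_op_δ_mem_null (J := J) ht l (f := g) hh hf
  have h3 := two_mul_op_δ_mem_null (J := J) ht l (f := h) hf hg
  -- In the cyclic sum the terms with the Fréchet derivative of a given `b` pair up into this
  -- difference, exact because that derivative is self-adjoint.
  have sym : ∀ a b c : A, J.IsSelfAdj b → 
      2 * (J.op t l a * J.fre b (J.op t l c) - J.op t l c * J.fre b (J.op t l a)) ∈ J.null := by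
    intro a b c hb
    have := J.mul_adj_sub_mem_null b (J.op t l a) (J.op t l c)
    rw [← hb] at this
    rw [two_mul]
    exact J.null.add_mem this this
  have s1 := sym f g h hg
  have s2 := sym g h f hh
  have s3 := sym h f g hf
  convert J.null.sub_mem (J.null.add_mem (J.null.add_mem h1 h2) h3)
    (J.null.add_mem (J.null.add_mem s1 s2) s3) using 1
  simp only [tri]
  ring

variable (J) in
/-- The bracket `{∫K, ∫L} = ∫ δK · op (δL)` satisfies the Jacobi identity. -/
def Jacobi (t l : A) : Prop := ∀ K L M : A,
  J.δ K * J.op t l (J.δ (J.δ L * J.op t l (J.δ M)))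
    + J.δ L * J.op t l (J.δ (J.δ M * J.op t l (J.δ K)))
    + J.δ M * J.op t l (J.δ (J.δ K * J.op t l (J.δ L))) ∈ J.null

lemma jacobi_iff {t : A} (ht : t + t = 1) (l : A) :
    J.Jacobi t l ↔ ∀ K L M : A, J.tri t l (J.δ K) (J.δ L) (J.δ M) ∈ J.null := by
  refine forall₃_congr fun K L M => ?_
  have h := jacobi_add_tri_mem_null ht l (J.fre_δ K) (J.fre_δ L) (J.fre_δ M)
  constructor
  · intro h1
    rw [two_mul] at h
    exact (J.null.add_mem_iff_right (J.null.add_mem h1 h1)).1 h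
  · intro h1
    have := (J.null.add_mem_iff_left h1).1 h
    rw [two_mul] at this
    exact mem_null_of_add_self ht this

end JetDer

end

/-! ### The obstruction `obs`, the cofactor `cof`, and their values at a point. -/

section

namespace JetDer

open Finset

variable {A : Type*} [CommRing A] {J : JetDer A}

variable (J) in
/-- The obstruction to the Jacobi identity for an `l` that depends on `u₀, u₁, u₂` only. -/
def obs (t l : A) : A := J.d 1 l * l + (1 + t) * J.d 2 l * J.D l - l * J.D (J.d 2 l)

lemma fre_of_order_two {l : A} (hl : ∀ k ≥ 3, J.d k l = 0) (w : A) :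
    J.fre l w = J.d 0 l * w + J.d 1 l * J.D w + J.d 2 l * J.D (J.D w) := by
  rw [J.fre_apply hl]
  simp [sum_range_succ, pow_succ]

lemma adj_of_order_two {l : A} (hl : ∀ k ≥ 3, J.d k l = 0) (w : A) :
    J.adj l w = J.d 0 l * w - J.D (J.d 1 l * w) + J.D (J.D (J.d 2 l * w)) := by
  rw [J.adj_apply hl]
  simp only [sum_range_succ, pow_succ, range_zero, sum_empty, pow_zero, one_mul,
    Module.End.mul_apply, Module.End.one_apply, E_apply, map_neg]
  ring

/-- The cyclic sums of `wr g h · f` and `wr g h · f'` vanish, so only `f''` and `f'''` contribute to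
`tri`. The total derivative below absorbs the `f'''` terms, and the remaining coefficient of the
cyclic sum of `wr g h · f''` is `obs`. -/
lemma jacobi_of_obs_eq_zero {t l : A} (ht : t + t = 1) (hl : ∀ k ≥ 3, J.d k l = 0)
    (hobs : J.obs t l = 0) : J.Jacobi t l := by
  rw [jacobi_iff ht]
  intro K L M
  generalize J.δ K = f
  generalize J.δ L = g
  generalize J.δ M = h
  convert J.D_mem_null (J.d 2 l * l * (J.wr g h * J.D (J.D f) + J.wr h f * J.D (J.D g)
    + J.wr f g * J.D (J.D h))) using 1
  simp only [tri, fre_of_order_two hl, op, wr, obs, Derivation.leibniz, map_add, map_sub,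
    smul_eq_mul, J.D_eq_zero_of_half ht] at *
  linear_combination ((g * J.D h - J.D g * h) * J.D (J.D f) + (h * J.D f - J.D h * f)
    * J.D (J.D g) + (f * J.D g - J.D f * g) * J.D (J.D h)) * hobs

variable (J) in
/-- The cofactor of `f` in `tri t l f g h`, modulo total derivatives. -/
def cof (t l g h : A) : A :=
  -J.op t l (J.adj l (J.wr g h)) + 2 * J.fre l (J.op t l h) * J.D g + J.D (J.fre l (J.op t l h)) * g
    - 2 * J.fre l (J.op t l g) * J.D h - J.D (J.fre l (J.op t l g)) * h

/-- Integration by parts moves every derivative off `f`: through the adjoint of the Fréchet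
derivative of `l`, the skew-adjointness of `op`, and the product rule for the two Wronskians
containing `f'`. -/
lemma tri_sub_mem_null {t : A} (ht : t + t = 1) (l f g h : A) :
    J.tri t l f g h - f * J.cof t l g h ∈ J.null := by
  have h1 := J.mul_adj_sub_mem_null l (J.op t l f) (J.wr g h)
  have h2 := mul_op_add_mem_null (J := J) ht l f (J.adj l (J.wr g h))
  have h3 := J.D_mem_null (J.fre l (J.op t l g) * h * f - J.fre l (J.op t l h) * g * f)
  convert J.null.add_mem (J.null.sub_mem h2 h1) h3 using 1
  simp only [tri, cof, Derivation.leibniz, map_sub, smul_eq_mul, wr]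
  ring

variable {k : Type*} [Field k]

variable (J) in
/-- `y` is the function `x - x₀` at a point with first coordinate `x₀` and evaluation `ev`. -/
structure IsPoint (ev : A →+* k) (y : A) : Prop where
  ev_y : ev y = 0
  D_y : J.D y = 1
  d_y : ∀ i, J.d i y = 0

section point

variable {ev : A →+* k} {y : A} (hp : J.IsPoint ev y)
include hp

lemma d_pow_mul (i m : ℕ) (b : A) : J.d i (y ^ m * b) = y ^ m * J.d i b := by
  simp [Derivation.leibniz, Derivation.leibniz_pow, hp.d_y]

lemma D_pow_mul (m : ℕ) (b : A) :
    J.D (y ^ (m + 1) * b) = y ^ m * (((m + 1 : ℕ) : A) * b + y * J.D b) := by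
  simp only [Derivation.leibniz, Derivation.leibniz_pow, hp.D_y, smul_eq_mul, nsmul_eq_mul,
    Nat.add_sub_cancel]
  ring

lemma ev_T_pow_of_lt {i m : ℕ} (h : i < m) (b : A) : ev ((J.T ^ i) (y ^ m * b)) = 0 := by
  induction i generalizing m b with
  | zero => simp [hp.ev_y, (show m ≠ 0 by omega)]
  | succ i ih =>
    obtain ⟨m, rfl⟩ := Nat.exists_eq_add_of_le' (show 1 ≤ m by omega)
    rw [pow_succ, Module.End.mul_apply, T_apply, D_pow_mul hp, ih (by omega)]

lemma ev_T_pow_self (m : ℕ) (b : A) : ev ((J.T ^ m) (y ^ m * b)) = m.factorial * ev b := by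
  induction m generalizing b with
  | zero => simp
  | succ m ih =>
    rw [pow_succ, Module.End.mul_apply, T_apply, D_pow_mul hp, ih]
    simp [hp.ev_y, Nat.factorial_succ]
    ring

/-- The variational derivative of `y ^ n * N` vanishes. At the point, `y ^ n` kills all terms with
fewer than `n` total derivatives, and the top one is `± n!` times `J.d n N`. -/
lemma ev_d_eq_zero_of_mem_null [CharZero k] {N : A} {n : ℕ} (hN : ∀ i > n, J.d i N = 0)
    (h : y ^ n * N ∈ J.null) : ev (J.d n N) = 0 := by
  have h1 := J.δ_of_mem_null h
  rw [J.δ_apply (n := n + 1) (fun i hi => by rw [d_pow_mul hp, hN i hi, mul_zero])] at h1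
  have h2 := congrArg ev h1
  rw [map_sum, map_zero, sum_range_succ, sum_eq_zero] at h2
  · simp only [d_pow_mul hp, E_pow_apply, map_mul, ev_T_pow_self hp, zero_add] at h2
    simpa [Nat.factorial_ne_zero] using h2
  · intro i hi
    rw [d_pow_mul hp, E_pow_apply, map_mul, ev_T_pow_of_lt hp (by simpa using hi), mul_zero]

variable {l : A} {n : ℕ} (hl : ∀ i > n, J.d i l = 0)
include hl

lemma ev_fre_of_lt {m : ℕ} (h : n < m) (b : A) : ev (J.fre l (y ^ m * b)) = 0 := by
  rw [J.fre_apply (n := n + 1) hl, map_sum]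
  refine sum_eq_zero fun i hi => ?_
  rw [map_mul, ev_T_pow_of_lt hp (by simp at hi; omega), mul_zero]

lemma ev_fre_self (b : A) : ev (J.fre l (y ^ n * b)) = n.factorial * ev (J.d n l) * ev b := by
  rw [J.fre_apply (n := n + 1) hl, map_sum, sum_range_succ, sum_eq_zero]
  · rw [map_mul, ev_T_pow_self hp]
    ring
  · intro i hi
    rw [map_mul, ev_T_pow_of_lt hp (by simpa using hi), mul_zero]

lemma ev_D_fre (b : A) :
    ev (J.D (J.fre l (y ^ (n + 1) * b))) = (n + 1).factorial * ev (J.d n l) * ev b := by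
  rw [J.fre_apply (n := n + 1) hl, map_sum, map_sum, sum_range_succ, sum_eq_zero]
  · rw [Derivation.leibniz, smul_eq_mul, smul_eq_mul, map_add, map_mul ev, map_mul ev,
      ev_T_pow_of_lt hp (by omega), ← T_apply, ← Module.End.mul_apply, ← pow_succ',
      ev_T_pow_self hp]
    ring
  · intro i hi
    rw [mem_range] at hi
    rw [Derivation.leibniz, smul_eq_mul, smul_eq_mul, map_add, map_mul ev, map_mul ev,
      ev_T_pow_of_lt hp (by omega), ← T_apply, ← Module.End.mul_apply, ← pow_succ',
      ev_T_pow_of_lt hp (by omega)]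
    ring

lemma ev_adj_of_lt {m : ℕ} (h : n < m) (b : A) : ev (J.adj l (y ^ m * b)) = 0 := by
  rw [J.adj_apply (n := n + 1) hl, map_sum]
  refine sum_eq_zero fun i hi => ?_
  rw [mul_left_comm, E_pow_apply, map_mul, ev_T_pow_of_lt hp (by simp at hi; omega), mul_zero]

lemma ev_D_adj (b : A) :
    ev (J.D (J.adj l (y ^ (n + 1) * b))) =
      (-1) ^ n * (n + 1).factorial * ev (J.d n l) * ev b := by
  have key : ∀ i (a : A), J.D ((J.E ^ i) a) = (-1) ^ i * (J.T ^ (i + 1)) a := by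
    intro i a
    rw [E_pow_apply, pow_succ', Module.End.mul_apply, T_apply]
    rcases Nat.even_or_odd i with h | h <;> simp [h.neg_one_pow]
  rw [J.adj_apply (n := n + 1) hl, map_sum, map_sum, sum_range_succ, sum_eq_zero]
  · rw [mul_left_comm, key, map_mul, ev_T_pow_self hp]
    simp
    ring
  · intro i hi
    rw [mem_range] at hi
    rw [mul_left_comm, key, map_mul, ev_T_pow_of_lt hp (by omega), mul_zero]

/-- At the point, `cof` is `(1 - (-1)^n) (n+2) (n+1)! · l · l_n`: the parity sign comes from the
adjoint. For even `n` this choice of powers gives nothing. -/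
lemma ev_mul_d_eq_zero_of_odd [CharZero k] {t : A} (hn : Odd n) (h : J.cof t l (y ^ 0) (y ^ (n + 2)) = 0) :
    ev l * ev (J.d n l) = 0 := by
  have e1 : J.wr (y ^ 0) (y ^ (n + 2)) = y ^ (n + 1) * ((n + 2 : ℕ) : A) := by
    have := D_pow_mul hp (n + 1) 1
    simp only [mul_one] at this
    simp only [wr, pow_zero, Derivation.map_one_eq_zero, this]
    push_cast
    ring
  have e2 : J.op t l (y ^ (n + 2)) = y ^ (n + 1) * ((n + 2 : ℕ) * l + t * J.D l * y) := by
    have := D_pow_mul hp (n + 1) 1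
    simp only [mul_one] at this
    rw [op, this]
    simp
    ring
  have e3 : ev (J.D (y ^ (n + 2))) = 0 := by
    have := D_pow_mul hp (n + 1) 1
    simp only [mul_one] at this
    simp [this, hp.ev_y]
  have h1 := congrArg ev h
  simp only [cof, e1, e2] at h1
  simp only [op, map_add, map_sub, map_mul, map_neg, map_zero,
    ev_adj_of_lt hp hl (Nat.lt_succ_self n),
    ev_D_adj hp hl, ev_fre_of_lt hp hl (Nat.lt_succ_self n), ev_D_fre hp hl, e3, hn.neg_one_pow,
    map_pow, hp.ev_y, map_natCast, pow_zero, map_one] at h1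
  have h2 : (2 * ((n + 1).factorial * (n + 2 : ℕ)) : k) * (ev l * ev (J.d n l)) = 0 := by
    rw [← h1]
    simp
    ring
  refine (mul_eq_zero.1 h2).resolve_left ?_
  norm_cast
  have := Nat.factorial_ne_zero (n + 1)
  simp [this]

/-- Here `cof` is `(2 - n) (n+1)! · l · l_n` at the point; the factor `2 - n` is why order 2
survives. -/
lemma ev_mul_d_eq_zero_of_even [CharZero k] {t : A} (hn : Even n) (hn2 : 2 < n)
    (h : J.cof t l y (y ^ (n + 1)) = 0) : ev l * ev (J.d n l) = 0 := by
  have e0 := D_pow_mul hp n 1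
  simp only [mul_one] at e0
  have e1 : J.wr y (y ^ (n + 1)) = y ^ (n + 1) * (n : A) := by
    rw [wr, e0, hp.D_y]
    simp
    ring
  have e2 : J.op t l (y ^ (n + 1)) = y ^ n * ((n + 1 : ℕ) * l + t * J.D l * y) := by
    rw [op, e0]
    simp
    ring
  have e3 : ev (J.D (y ^ (n + 1))) = 0 := by
    rw [e0]
    simp [hp.ev_y]
    omega
  have h1 := congrArg ev h
  simp only [cof, e1, e2] at h1
  simp only [op, map_add, map_sub, map_mul, map_neg, map_zero,
    ev_adj_of_lt hp hl (Nat.lt_succ_self n),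
    ev_D_adj hp hl, ev_fre_self hp hl, e3, hn.neg_one_pow, hp.D_y,
    map_pow, hp.ev_y, map_natCast, map_ofNat, map_one] at h1
  have h2 : ((n + 1).factorial * (2 - n) : k) * (ev l * ev (J.d n l)) = 0 := by
    rw [← h1]
    simp [Nat.factorial_succ]
    ring
  refine (mul_eq_zero.1 h2).resolve_left (mul_ne_zero (mod_cast Nat.factorial_ne_zero _) ?_)
  rw [sub_ne_zero]
  norm_cast
  omega

end point

/-- With `g = y` and `h = y ^ 2`, the value of `cof` at the point is `6 * obs`. -/
lemma ev_obs_eq_zero [CharZero k] {ev : A →+* k} {y : A} (hp : J.IsPoint ev y) {t l : A} (ht : t + t = 1)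
    (hl : ∀ k ≥ 3, J.d k l = 0) (h : J.cof t l y (y ^ 2) = 0) : ev (J.obs t l) = 0 := by
  have ht' : ev t + ev t = 1 := by rw [← map_add, ht, map_one]
  have h1 := congrArg ev h
  simp only [cof, fre_of_order_two hl, adj_of_order_two hl, op, wr, pow_two, Derivation.leibniz,
    map_add, map_sub, smul_eq_mul, hp.D_y, J.D_eq_zero_of_half ht, map_mul, hp.ev_y, map_one,
    map_neg, map_zero, Derivation.map_one_eq_zero, mul_zero, zero_mul, add_zero, zero_add,
    mul_one, one_mul, map_ofNat, sub_zero] at h1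
  simp only [obs, map_add, map_sub, map_mul, map_one]
  have : (6 : k) ≠ 0 := by norm_num
  apply mul_left_cancel₀ this
  linear_combination h1 + 2 * ev (J.d 2 l) * ev (J.D l) * ht'

end JetDer

end

/-! ### Necessary conditions from test functionals, and removal of zero divisors. -/

section

namespace JetDer

open Finset

variable {A : Type*} [CommRing A] {J : JetDer A} {k : Type*} [Field k]

lemma δ_of_d_succ_eq_zero {a : A} (h : ∀ i, J.d (i + 1) a = 0) : J.δ a = J.d 0 a := by
  rw [J.δ_apply (n := 1)]
  · simp
  · intro i hi
    obtain ⟨i, rfl⟩ := Nat.exists_eq_add_of_le' hi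
    exact h i

lemma δ_pow_mul {ev : A →+* k} {y : A} (hp : J.IsPoint ev y) {u : A} (hu0 : J.d 0 u = 1)
    (hu : ∀ i, J.d (i + 1) u = 0) (m : ℕ) : J.δ (y ^ m * u) = y ^ m := by
  rw [δ_of_d_succ_eq_zero, d_pow_mul hp, hu0, mul_one]
  intro i
  rw [d_pow_mul hp, hu, mul_zero]

lemma δ_pow_mul_sq {ev : A →+* k} {y : A} (hp : J.IsPoint ev y) {t u : A} (ht : t + t = 1)
    (hu0 : J.d 0 u = 1) (hu : ∀ i, J.d (i + 1) u = 0) (m : ℕ) :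
    J.δ (y ^ m * (t * u ^ 2)) = y ^ m * u := by
  rw [δ_of_d_succ_eq_zero, d_pow_mul hp]
  · simp only [Derivation.leibniz, Derivation.leibniz_pow, hu0, J.d_eq_zero_of_half ht,
      smul_eq_mul, nsmul_eq_mul]
    push_cast
    linear_combination (y ^ m * u) * ht
  · intro i
    rw [d_pow_mul hp]
    simp [Derivation.leibniz, Derivation.leibniz_pow, hu, J.d_eq_zero_of_half ht]

variable {ι : Type*} {ev : ι → A →+* k} {y : ι → A} (hp : ∀ p, J.IsPoint (ev p) (y p))
  (sep : ∀ a, (∀ p, ev p a = 0) → a = 0)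
include hp sep

lemma d_eq_zero_of_mem_null [CharZero k] {N : A} (h : ∀ p m, y p ^ m * N ∈ J.null) (i : ℕ) :
    J.d i N = 0 := by
  obtain ⟨n, hn⟩ := J.finite N
  induction n with
  | zero => exact hn i (Nat.zero_le i)
  | succ n ih =>
    refine ih fun j hj => ?_
    rcases hj.eq_or_lt with rfl | hj
    · exact sep _ fun p => ev_d_eq_zero_of_mem_null (hp p) (fun i hi => hn i hi) (h p n)
    · exact hn j hj

/-- The first family shows that `N` does not depend on the jet coordinates; then `N` is the
derivative of `u * N` by `u₀`, which vanishes by the second family. -/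
lemma eq_zero_of_mem_null [CharZero k] {u : A} (hu0 : J.d 0 u = 1) {N : A}
    (h : ∀ p m, y p ^ m * N ∈ J.null) (h' : ∀ p m, y p ^ m * (u * N) ∈ J.null) : N = 0 := by
  have h1 := d_eq_zero_of_mem_null hp sep h' 0
  simpa [Derivation.leibniz, d_eq_zero_of_mem_null hp sep h 0, hu0] using h1

lemma cof_eq_zero [CharZero k] {t l : A} (ht : t + t = 1) {u : A} (hu0 : J.d 0 u = 1)
    (hu : ∀ i, J.d (i + 1) u = 0) (hJ : J.Jacobi t l) (p : ι) (a b : ℕ) :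
    J.cof t l (y p ^ a) (y p ^ b) = 0 := by
  rw [jacobi_iff ht] at hJ
  refine eq_zero_of_mem_null hp sep hu0 (fun q m => ?_) (fun q m => ?_)
  -- The variational derivatives of these densities are the pure powers of `y`; in the second case
  -- the factor `t * u ^ 2` gives `y q ^ m * u` instead.
  · have h1 := hJ (y q ^ m * u) (y p ^ a * u) (y p ^ b * u)
    rw [δ_pow_mul (hp q) hu0 hu, δ_pow_mul (hp p) hu0 hu, δ_pow_mul (hp p) hu0 hu] at h1
    exact (sub_mem_comm_iff.trans (Submodule.sub_mem_iff_left _ h1)).1 (tri_sub_mem_null ht ..)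
  · have h1 := hJ (y q ^ m * (t * u ^ 2)) (y p ^ a * u) (y p ^ b * u)
    rw [δ_pow_mul_sq (hp q) ht hu0 hu, δ_pow_mul (hp p) hu0 hu, δ_pow_mul (hp p) hu0 hu] at h1
    rw [← mul_assoc]
    exact (sub_mem_comm_iff.trans (Submodule.sub_mem_iff_left _ h1)).1 (tri_sub_mem_null ht ..)

omit hp sep in
-- Differentiating gives `l_i² + l l_ii = 0`; multiplication by `l_i` kills the second term, so
-- `l_i³ = 0`.
lemma d_eq_zero_of_mul_d_eq_zero [IsReduced A] {l : A} (i : ℕ) (h : l * J.d i l = 0) :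
    J.d i l = 0 := by
  have h1 := congrArg (J.d i) h
  simp only [Derivation.leibniz, smul_eq_mul, map_zero] at h1
  refine eq_zero_of_pow_eq_zero (n := 3) ?_
  linear_combination J.d i l * h1 - J.d i (J.d i l) * h

lemma d_eq_zero_of_jacobi [CharZero k] [IsReduced A] {t l : A} (ht : t + t = 1) {u : A} (hu0 : J.d 0 u = 1)
    (hu : ∀ i, J.d (i + 1) u = 0) (hJ : J.Jacobi t l) : ∀ i ≥ 3, J.d i l = 0 := by
  have hc := cof_eq_zero hp sep ht hu0 hu hJ
  obtain ⟨n, hn⟩ := J.finite l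
  induction n with
  | zero => exact fun i _ => hn i (Nat.zero_le i)
  | succ n ih =>
    by_cases h3 : 3 ≤ n
    · refine ih fun j hj => ?_
      rcases hj.eq_or_lt with rfl | hj
      · refine d_eq_zero_of_mul_d_eq_zero _ (sep _ fun p => ?_)
        rw [map_mul]
        rcases Nat.even_or_odd n with h | h
        · have := hc p 1 (n + 1)
          rw [pow_one] at this
          exact ev_mul_d_eq_zero_of_even (hp p) hn h h3 this
        · exact ev_mul_d_eq_zero_of_odd (hp p) hn h (hc p _ _)
      · exact hn j hj
    · exact fun i hi => hn i (by omega)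

lemma obs_eq_zero_of_jacobi [CharZero k] [IsReduced A] {t l : A} (ht : t + t = 1) {u : A} (hu0 : J.d 0 u = 1)
    (hu : ∀ i, J.d (i + 1) u = 0) (hJ : J.Jacobi t l) : J.obs t l = 0 := by
  refine sep _ fun p => ev_obs_eq_zero (hp p) ht (d_eq_zero_of_jacobi hp sep ht hu0 hu hJ) ?_
  have := cof_eq_zero hp sep ht hu0 hu hJ p 1 2
  rwa [pow_one] at this

omit hp sep

lemma eq_zero_of_mul_eq_zero_of_d [IsReduced A] {i : ℕ} {v a : A} (hv : J.d i v = 1)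
    (h : v * a = 0) : a = 0 := by
  have h1 := congrArg (J.d i) h
  simp only [Derivation.leibniz, smul_eq_mul, map_zero, hv] at h1
  refine eq_zero_of_pow_eq_zero (n := 2) ?_
  linear_combination a * h1 - J.d i a * h

/-- With `P = obs` and `l P = 0`, only the term `(1 + t) l_2 l'` of `obs` survives in `P³`, and `l'
P = -l P'` makes that vanish as well. -/
lemma obs_eq_zero_of_mul_obs_eq_zero [IsReduced A] {t l : A} (h : l * J.obs t l = 0) :
    J.obs t l = 0 := by
  have h1 := congrArg J.D h
  simp only [Derivation.leibniz, smul_eq_mul, map_zero] at h1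
  refine eq_zero_of_pow_eq_zero (n := 3) ?_
  have h2 : J.obs t l ^ 3 = (J.d 1 l * l + (1 + t) * J.d 2 l * J.D l - l * J.D (J.d 2 l))
    * J.obs t l ^ 2 := by rw [obs]; ring
  rw [h2]
  linear_combination ((J.d 1 l - J.D (J.d 2 l)) * J.obs t l - (1 + t) * J.d 2 l * J.D (J.obs t l))
    * h + ((1 + t) * J.d 2 l * J.obs t l) * h1

/-- The Jacobi identity in terms of the vanishing of the obstruction after multiplication by
`l * v`, where `v` plays the role of `u₁`. -/
lemma jacobi_of_mul_eq_zero [IsReduced A] {t l v : A} (ht : t + t = 1) (hv : J.d 1 v = 1)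
    (h3 : ∀ i ≥ 3, v * (l * J.d i l) = 0) (h : v * (l * J.obs t l) = 0) : J.Jacobi t l :=
  jacobi_of_obs_eq_zero ht
    (fun i hi => d_eq_zero_of_mul_d_eq_zero i (eq_zero_of_mul_eq_zero_of_d hv (h3 i hi)))
    (obs_eq_zero_of_mul_obs_eq_zero (eq_zero_of_mul_eq_zero_of_d hv h))

end JetDer

end

/-! ### Jet calculus in finitely many coordinates: partial and total derivatives as Fréchet
derivatives. -/

section

open Filter Topology Finset

variable {𝕜 : Type*} [RCLike 𝕜]

/-- The `i`-th coordinate direction `∂/∂uᵢ` in `ℝ × ℝⁿ`, which is `0` for `i ≥ n`. -/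
def dirU (n i : ℕ) : ℝ × (Fin n → ℝ) := (0, fun j => if (j : ℕ) = i then 1 else 0)

/-- The direction `∂/∂x + ∑ uᵢ₊₁ ∂/∂uᵢ` of the total derivative in `ℝ × ℝⁿ`. -/
def dirD (n : ℕ) (p : Jet) : ℝ × (Fin n → ℝ) := (1, fun j => p.2 (j + 1))

/-- The function `K` is given on `Ω` by the smooth function `F` of `x, u₀, …, u_{n-1}`. -/
def IsGivenBy (Ω : Set Jet) (n : ℕ) (F : ℝ × (Fin n → ℝ) → 𝕜) (K : Jet → 𝕜) : Prop :=
  ContDiffOn ℝ ∞ F (proj n '' Ω) ∧ ∀ p ∈ Ω, K p = F (proj n p)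

/-- The projection that forgets the last coordinates. -/
def cut {n m : ℕ} (h : n ≤ m) : ℝ × (Fin m → ℝ) →L[ℝ] ℝ × (Fin n → ℝ) :=
  (ContinuousLinearMap.fst ℝ ℝ (Fin m → ℝ)).prod
    (ContinuousLinearMap.pi fun i =>
      (ContinuousLinearMap.proj (Fin.castLE h i)).comp (ContinuousLinearMap.snd ℝ ℝ (Fin m → ℝ)))

@[simp] lemma cut_proj {n m : ℕ} (h : n ≤ m) (p : Jet) : cut h (proj m p) = proj n p := rfl

@[simp] lemma cut_dirU {n m : ℕ} (h : n ≤ m) (i : ℕ) : cut h (dirU m i) = dirU n i := rfl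

lemma continuous_proj (n : ℕ) : Continuous (proj n) := by
  unfold proj
  fun_prop

/-- The jet with the coordinates of `q` followed by those of `p`. -/
def splice {n : ℕ} (p : Jet) (q : ℝ × (Fin n → ℝ)) : Jet :=
  (q.1, fun i => if h : i < n then q.2 ⟨i, h⟩ else p.2 i)

lemma continuous_splice {n : ℕ} (p : Jet) : Continuous (splice (n := n) p) := by
  refine continuous_fst.prodMk (continuous_pi fun i => ?_)
  by_cases h : i < n <;> simp only [h, dite_true, dite_false] <;> fun_prop

@[simp] lemma proj_splice {n : ℕ} (p : Jet) (q : ℝ × (Fin n → ℝ)) : proj n (splice p q) = q := by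
  simp [proj, splice]

@[simp] lemma splice_proj {n : ℕ} (p : Jet) : splice p (proj n p) = p := by
  simp [proj, splice]

/-- `splice p` is a continuous local section of the projection through `p`. -/
lemma isOpen_proj_image {Ω : Set Jet} (hΩ : IsOpen Ω) (n : ℕ) : IsOpen (proj n '' Ω) := by
  rw [isOpen_iff_mem_nhds]
  rintro _ ⟨p, hp, rfl⟩
  have : splice p ⁻¹' Ω ∈ 𝓝 (proj n p) :=
    (hΩ.preimage (continuous_splice p)).mem_nhds (by simpa using hp)
  exact mem_of_superset this fun q hq => ⟨_, hq, proj_splice p q⟩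

namespace IsGivenBy

variable {Ω : Set Jet} {n m : ℕ} {F G : ℝ × (Fin n → ℝ) → 𝕜} {K L : Jet → 𝕜}

lemma isSmoothFin (h : IsGivenBy Ω n F K) : IsSmoothFin Ω K := ⟨n, F, h⟩

lemma mono (h : IsGivenBy Ω n F K) (hnm : n ≤ m) : IsGivenBy Ω m (F ∘ cut hnm) K := by
  refine ⟨h.1.comp (cut hnm).contDiff.contDiffOn ?_, fun p hp => by simp [h.2 p hp]⟩
  rintro _ ⟨p, hp, rfl⟩
  exact ⟨p, hp, rfl⟩

lemma congr (h : IsGivenBy Ω n F K) (hKL : ∀ p ∈ Ω, L p = K p) : IsGivenBy Ω n F L :=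
  ⟨h.1, fun p hp => by rw [hKL p hp, h.2 p hp]⟩

lemma add (h : IsGivenBy Ω n F K) (h' : IsGivenBy Ω n G L) : IsGivenBy Ω n (F + G) (K + L) :=
  ⟨h.1.add h'.1, fun p hp => by simp [h.2 p hp, h'.2 p hp]⟩

lemma mul (h : IsGivenBy Ω n F K) (h' : IsGivenBy Ω n G L) : IsGivenBy Ω n (F * G) (K * L) :=
  ⟨h.1.mul h'.1, fun p hp => by simp [h.2 p hp, h'.2 p hp]⟩

variable (hΩ : IsOpen Ω) (h : IsGivenBy Ω n F K) {p : Jet} (hp : p ∈ Ω)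
include hΩ h hp

lemma contDiffAt : ContDiffAt ℝ ∞ F (proj n p) :=
  h.1.contDiffAt ((isOpen_proj_image hΩ n).mem_nhds ⟨p, hp, rfl⟩)

lemma hasFDerivAt : HasFDerivAt F (fderiv ℝ F (proj n p)) (proj n p) :=
  ((h.contDiffAt hΩ hp).differentiableAt (by simp)).hasFDerivAt

lemma eventuallyEq : K =ᶠ[𝓝 p] F ∘ proj n :=
  mem_of_superset (hΩ.mem_nhds hp) fun q hq => h.2 q hq

lemma partialU_eq (i : ℕ) : partialU i K p = fderiv ℝ F (proj n p) (dirU n i) := by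
  have hc : HasDerivAt (fun t : ℝ => proj n (p.1, Function.update p.2 i t)) (dirU n i) (p.2 i) := by
    refine (hasDerivAt_const _ _).prodMk (hasDerivAt_pi.2 fun j => ?_)
    by_cases hj : (j : ℕ) = i
    · subst hj
      simpa only [Function.update_self, if_true] using hasDerivAt_id' (p.2 j)
    · simpa [Function.update_of_ne hj, hj] using hasDerivAt_const (p.2 i) (p.2 j)
  have hF := h.hasFDerivAt hΩ hp
  have e : (p.1, Function.update p.2 i (p.2 i)) = p := by simp
  rw [← e] at hF
  have h1 := hF.comp_hasDerivAt (p.2 i) hc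
  rw [e] at h1
  refine (h1.congr_of_eventuallyEq ?_).deriv
  have hcont : Continuous fun t : ℝ => ((p.1, Function.update p.2 i t) : Jet) :=
    continuous_const.prodMk (continuous_const.update i continuous_id)
  have ht : Tendsto (fun t : ℝ => ((p.1, Function.update p.2 i t) : Jet)) (𝓝 (p.2 i)) (𝓝 p) := by
    have := hcont.tendsto (p.2 i)
    rwa [e] at this
  exact ht.eventually (h.eventuallyEq hΩ hp)

lemma partialX_eq : partialX K p = fderiv ℝ F (proj n p) (1, 0) := by
  have hc : HasDerivAt (fun t : ℝ => proj n (t, p.2)) (1, 0) p.1 :=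
    (hasDerivAt_id _).prodMk (hasDerivAt_pi.2 fun j => hasDerivAt_const _ (p.2 j))
  have h1 := (h.hasFDerivAt hΩ hp).comp_hasDerivAt p.1 hc
  refine (h1.congr_of_eventuallyEq ?_).deriv
  have hcont : Continuous fun t : ℝ => ((t, p.2) : Jet) := by fun_prop
  exact (hcont.tendsto p.1).eventually (h.eventuallyEq hΩ hp)

lemma partialU_of_le {i : ℕ} (hi : n ≤ i) : partialU i K p = 0 := by
  rw [h.partialU_eq hΩ hp]
  have : dirU n i = 0 := by
    ext j
    · rfl
    · have : (j : ℕ) ≠ i := by omega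
      simp [dirU, this]
  rw [this, map_zero]

lemma totalD_eq_sum : totalD K p = partialX K p + ∑ i ∈ range n, p.2 (i + 1) • partialU i K p := by
  rw [totalD, finsum_eq_sum_of_support_subset]
  intro i hi
  by_contra hni
  exact hi (by simp only [h.partialU_of_le hΩ hp (by simpa using hni), smul_zero])

lemma totalD_eq : totalD K p = fderiv ℝ F (proj n p) (dirD n p) := by
  rw [h.totalD_eq_sum hΩ hp, h.partialX_eq hΩ hp]
  simp only [h.partialU_eq hΩ hp, ← map_smul]
  rw [← map_sum, ← map_add]
  congr 1
  ext j
  · simp [dirD, dirU, Prod.fst_sum]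
  · simp [dirD, dirU, Prod.snd_sum]

omit hp in
lemma fderiv_contDiffOn : ContDiffOn ℝ ∞ (fderiv ℝ F) (proj n '' Ω) :=
  h.1.fderiv_of_isOpen (isOpen_proj_image hΩ n) (by simp)

omit hp in
lemma partialU (i : ℕ) :
    IsGivenBy Ω n (fun q => fderiv ℝ F q (dirU n i)) (JetCalculus.partialU i K) :=
  ⟨(h.fderiv_contDiffOn hΩ).clm_apply contDiffOn_const, fun _ hp => h.partialU_eq hΩ hp i⟩

omit hp in
lemma totalD :
    IsGivenBy Ω (n + 1)
      (fun q => fderiv ℝ F (cut (Nat.le_succ n) q) (1, fun j => q.2 j.succ))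
      (JetCalculus.totalD K) := by
  refine ⟨ContDiffOn.clm_apply ((h.fderiv_contDiffOn hΩ).comp
    (cut (Nat.le_succ n)).contDiff.contDiffOn ?_) (ContDiff.contDiffOn (by fun_prop)),
    fun p hp => h.totalD_eq hΩ hp⟩
  rintro _ ⟨p, hp, rfl⟩
  exact ⟨p, hp, rfl⟩

lemma fderiv_hasFDerivAt :
    HasFDerivAt (fderiv ℝ F) (fderiv ℝ (fderiv ℝ F) (proj n p)) (proj n p) :=
  (((h.fderiv_contDiffOn hΩ).contDiffAt
    ((isOpen_proj_image hΩ n).mem_nhds ⟨p, hp, rfl⟩)).differentiableAt (by simp)).hasFDerivAt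

lemma symm (v w : ℝ × (Fin n → ℝ)) : fderiv ℝ (fderiv ℝ F) (proj n p) v w =
    fderiv ℝ (fderiv ℝ F) (proj n p) w v :=
  ((h.contDiffAt hΩ hp).isSymmSndFDerivAt (by
    rw [minSmoothness_of_isRCLikeNormedField]
    exact WithTop.coe_le_coe.2 (le_top : (2 : ℕ∞) ≤ ⊤))) v w

lemma fderiv_partialU (i : ℕ) (v : ℝ × (Fin n → ℝ)) :
    fderiv ℝ (fun q => fderiv ℝ F q (dirU n i)) (proj n p) v =
      fderiv ℝ (fderiv ℝ F) (proj n p) v (dirU n i) := by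
  rw [((h.fderiv_hasFDerivAt hΩ hp).clm_apply (hasFDerivAt_const _ _)).fderiv]
  simp

lemma partialU_comm (i j : ℕ) : JetCalculus.partialU i (JetCalculus.partialU j K) p =
    JetCalculus.partialU j (JetCalculus.partialU i K) p := by
  rw [(h.partialU hΩ j).partialU_eq hΩ hp, (h.partialU hΩ i).partialU_eq hΩ hp,
    h.fderiv_partialU hΩ hp, h.fderiv_partialU hΩ hp, h.symm hΩ hp]

lemma totalD_partialU (i : ℕ) : JetCalculus.totalD (JetCalculus.partialU i K) p =
    fderiv ℝ (fderiv ℝ F) (proj n p) (dirU n i) (dirD n p) := by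
  rw [(h.partialU hΩ i).totalD_eq hΩ hp, h.fderiv_partialU hΩ hp, h.symm hΩ hp]

/-- `D` pairs the differential of `F` with a direction that itself depends on the coordinates. The
extra term is the derivative of that direction: `∂/∂uᵢ₋₁`, or zero for `i = 0`, whence the index `j
+ 1 = i`. -/
lemma partialU_totalD (i : ℕ) : JetCalculus.partialU i (JetCalculus.totalD K) p =
    JetCalculus.totalD (JetCalculus.partialU i K) p
      + fderiv ℝ F (proj n p) (0, fun j => if (j : ℕ) + 1 = i then 1 else 0) := by
  rw [(h.totalD hΩ).partialU_eq hΩ hp, h.totalD_partialU hΩ hp]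
  let s : ℝ × (Fin (n + 1) → ℝ) →L[ℝ] ℝ × (Fin n → ℝ) :=
    (0 : ℝ × (Fin (n + 1) → ℝ) →L[ℝ] ℝ).prod (ContinuousLinearMap.pi fun j =>
      (ContinuousLinearMap.proj j.succ).comp (ContinuousLinearMap.snd ℝ ℝ (Fin (n + 1) → ℝ)))
  have hs : HasFDerivAt (fun q : ℝ × (Fin (n + 1) → ℝ) =>
      ((1, fun j => q.2 j.succ) : ℝ × (Fin n → ℝ))) s (proj (n + 1) p) := by
    have := s.hasFDerivAt (x := proj (n + 1) p) |>.const_add ((1, 0) : ℝ × (Fin n → ℝ))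
    refine this.congr_of_eventuallyEq (Eventually.of_forall fun q => ?_)
    ext <;> simp [s]
  have hc : HasFDerivAt (fun q => fderiv ℝ F (cut (Nat.le_succ n) q)) _ (proj (n + 1) p) :=
    HasFDerivAt.comp (proj (n + 1) p) (by simpa using h.fderiv_hasFDerivAt hΩ hp)
      (cut (Nat.le_succ n)).hasFDerivAt
  rw [(hc.clm_apply hs).fderiv]
  simp only [add_apply, ContinuousLinearMap.comp_apply,
    ContinuousLinearMap.flip_apply, cut_proj, cut_dirU]
  rw [add_comm]
  congr 2

omit h in
lemma totalD_congr (hKL : ∀ p ∈ Ω, L p = K p) (hK : IsSmoothFin Ω K) :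
    JetCalculus.totalD L p = JetCalculus.totalD K p := by
  obtain ⟨n, F, h⟩ := hK
  have h : IsGivenBy Ω n F K := h
  rw [h.totalD_eq hΩ hp, (h.congr hKL).totalD_eq hΩ hp]

omit h in
lemma partialU_congr (hKL : ∀ p ∈ Ω, L p = K p) (hK : IsSmoothFin Ω K) (i : ℕ) :
    JetCalculus.partialU i L p = JetCalculus.partialU i K p := by
  obtain ⟨n, F, h⟩ := hK
  have h : IsGivenBy Ω n F K := h
  rw [h.partialU_eq hΩ hp, (h.congr hKL).partialU_eq hΩ hp]

end IsGivenBy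

lemma IsSmoothFin.exists_common {Ω : Set Jet} {K L : Jet → 𝕜} (hK : IsSmoothFin Ω K)
    (hL : IsSmoothFin Ω L) :
    ∃ n F G, IsGivenBy Ω n F K ∧ IsGivenBy Ω n G L := by
  obtain ⟨m, F, hF⟩ := hK
  obtain ⟨n, G, hG⟩ := hL
  exact ⟨max m n, _, _, IsGivenBy.mono hF (le_max_left _ _), IsGivenBy.mono hG (le_max_right _ _)⟩

end

/-! ### The algebra of smooth functions as an instance of the abstract calculus. -/

section

open Filter Topology Finset

variable {𝕜 : Type*} [RCLike 𝕜] {Ω : Set Jet}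

namespace IsSmoothFin

variable {K L : Jet → 𝕜}

lemma congr (hK : IsSmoothFin Ω K) (h : ∀ p ∈ Ω, L p = K p) : IsSmoothFin Ω L := by
  obtain ⟨n, F, hF⟩ := hK
  exact ⟨n, F, IsGivenBy.congr hF h⟩

lemma const (c : 𝕜) : IsSmoothFin Ω fun _ => c := ⟨0, fun _ => c, contDiffOn_const, fun _ _ => rfl⟩

lemma add (hK : IsSmoothFin Ω K) (hL : IsSmoothFin Ω L) : IsSmoothFin Ω (K + L) := by
  obtain ⟨n, F, G, hF, hG⟩ := hK.exists_common hL
  exact (hF.add hG).isSmoothFin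

lemma mul (hK : IsSmoothFin Ω K) (hL : IsSmoothFin Ω L) : IsSmoothFin Ω (K * L) := by
  obtain ⟨n, F, G, hF, hG⟩ := hK.exists_common hL
  exact (hF.mul hG).isSmoothFin

lemma partialU (hΩ : IsOpen Ω) (hK : IsSmoothFin Ω K) (i : ℕ) :
    IsSmoothFin Ω (JetCalculus.partialU i K) := by
  obtain ⟨n, F, hF⟩ := hK
  exact (IsGivenBy.partialU hΩ hF i).isSmoothFin

lemma totalD (hΩ : IsOpen Ω) (hK : IsSmoothFin Ω K) : IsSmoothFin Ω (JetCalculus.totalD K) := by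
  obtain ⟨n, F, hF⟩ := hK
  exact (IsGivenBy.totalD hΩ hF).isSmoothFin

variable (hΩ : IsOpen Ω) {p : Jet} (hp : p ∈ Ω)
include hΩ hp

lemma partialU_add (hK : IsSmoothFin Ω K) (hL : IsSmoothFin Ω L) (i : ℕ) :
    JetCalculus.partialU i (K + L) p = JetCalculus.partialU i K p + JetCalculus.partialU i L p := by
  obtain ⟨n, F, G, hF, hG⟩ := hK.exists_common hL
  rw [(hF.add hG).partialU_eq hΩ hp, hF.partialU_eq hΩ hp, hG.partialU_eq hΩ hp,
    ((hF.hasFDerivAt hΩ hp).add (hG.hasFDerivAt hΩ hp)).fderiv]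
  rfl

lemma totalD_add (hK : IsSmoothFin Ω K) (hL : IsSmoothFin Ω L) :
    JetCalculus.totalD (K + L) p = JetCalculus.totalD K p + JetCalculus.totalD L p := by
  obtain ⟨n, F, G, hF, hG⟩ := hK.exists_common hL
  rw [(hF.add hG).totalD_eq hΩ hp, hF.totalD_eq hΩ hp, hG.totalD_eq hΩ hp,
    ((hF.hasFDerivAt hΩ hp).add (hG.hasFDerivAt hΩ hp)).fderiv]
  rfl

lemma partialU_mul (hK : IsSmoothFin Ω K) (hL : IsSmoothFin Ω L) (i : ℕ) :
    JetCalculus.partialU i (K * L) p =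
      K p * JetCalculus.partialU i L p + L p * JetCalculus.partialU i K p := by
  obtain ⟨n, F, G, hF, hG⟩ := hK.exists_common hL
  rw [(hF.mul hG).partialU_eq hΩ hp, hF.partialU_eq hΩ hp, hG.partialU_eq hΩ hp,
    ((hF.hasFDerivAt hΩ hp).mul (hG.hasFDerivAt hΩ hp)).fderiv, hF.2 p hp, hG.2 p hp]
  rfl

lemma totalD_mul (hK : IsSmoothFin Ω K) (hL : IsSmoothFin Ω L) :
    JetCalculus.totalD (K * L) p =
      K p * JetCalculus.totalD L p + L p * JetCalculus.totalD K p := by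
  obtain ⟨n, F, G, hF, hG⟩ := hK.exists_common hL
  rw [(hF.mul hG).totalD_eq hΩ hp, hF.totalD_eq hΩ hp, hG.totalD_eq hΩ hp,
    ((hF.hasFDerivAt hΩ hp).mul (hG.hasFDerivAt hΩ hp)).fderiv, hF.2 p hp, hG.2 p hp]
  rfl

lemma partialU_comm (hK : IsSmoothFin Ω K) (i j : ℕ) :
    JetCalculus.partialU i (JetCalculus.partialU j K) p =
      JetCalculus.partialU j (JetCalculus.partialU i K) p := by
  obtain ⟨n, F, hF⟩ := hK
  exact IsGivenBy.partialU_comm hΩ hF hp i j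

lemma partialU_zero_totalD (hK : IsSmoothFin Ω K) :
    JetCalculus.partialU 0 (JetCalculus.totalD K) p =
      JetCalculus.totalD (JetCalculus.partialU 0 K) p := by
  obtain ⟨n, F, hF⟩ := hK
  rw [IsGivenBy.partialU_totalD hΩ hF hp]
  have : ((0, fun j => if (j : ℕ) + 1 = 0 then 1 else 0) : ℝ × (Fin n → ℝ)) = 0 := by
    ext <;> simp
  rw [this, map_zero, add_zero]

lemma partialU_succ_totalD (hK : IsSmoothFin Ω K) (i : ℕ) :
    JetCalculus.partialU (i + 1) (JetCalculus.totalD K) p =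
      JetCalculus.totalD (JetCalculus.partialU (i + 1) K) p + JetCalculus.partialU i K p := by
  obtain ⟨n, F, hF⟩ := hK
  rw [IsGivenBy.partialU_totalD hΩ hF hp, IsGivenBy.partialU_eq hΩ hF hp]
  simp [dirU]

end IsSmoothFin

variable (𝕜 Ω) in
/-- The smooth functions of finitely many jet coordinates, as a ring of functions on `Ω`. -/
def jetSubring : Subring (Ω → 𝕜) where
  carrier := {a | ∃ K : Jet → 𝕜, IsSmoothFin Ω K ∧ ∀ p : Ω, K p = a p}
  add_mem' := by
    rintro a b ⟨K, hK, ha⟩ ⟨L, hL, hb⟩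
    exact ⟨K + L, hK.add hL, fun p => by simp [ha, hb]⟩
  mul_mem' := by
    rintro a b ⟨K, hK, ha⟩ ⟨L, hL, hb⟩
    exact ⟨K * L, hK.mul hL, fun p => by simp [ha, hb]⟩
  zero_mem' := ⟨fun _ => 0, .const 0, fun _ => rfl⟩
  one_mem' := ⟨fun _ => 1, .const 1, fun _ => rfl⟩
  neg_mem' := by
    rintro a ⟨K, hK, ha⟩
    exact ⟨(fun _ => -1) * K, (IsSmoothFin.const (-1)).mul hK, fun p => by simp [ha]⟩

variable (𝕜 Ω) in
/-- The algebra `𝓕(Ω)`. -/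
def JetRing : Type _ := ↥(jetSubring 𝕜 Ω)

instance : CommRing (JetRing 𝕜 Ω) := inferInstanceAs (CommRing ↥(jetSubring 𝕜 Ω))

instance : IsReduced (JetRing 𝕜 Ω) :=
  isReduced_of_injective (jetSubring 𝕜 Ω).subtype Subtype.val_injective

/-- Evaluation at a point. -/
def evAt (p : Ω) : JetRing 𝕜 Ω →+* 𝕜 := (Pi.evalRingHom _ p).comp (jetSubring 𝕜 Ω).subtype

lemma JetRing.ext {a b : JetRing 𝕜 Ω} (h : ∀ p, evAt p a = evAt p b) : a = b :=
  Subtype.ext (funext h)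

lemma exists_rep (a : JetRing 𝕜 Ω) : ∃ K : Jet → 𝕜, IsSmoothFin Ω K ∧ ∀ p : Ω, K p = evAt p a :=
  Subtype.property a

/-- The function `K` on the jet space represents the element `a` of `𝓕(Ω)`. -/
def Rep (K : Jet → 𝕜) (a : JetRing 𝕜 Ω) : Prop := ∀ p : Ω, K p = evAt p a

/-- A function on the jet space that represents `a`. -/
def rep (a : JetRing 𝕜 Ω) : Jet → 𝕜 := (exists_rep a).choose

lemma isSmoothFin_rep (a : JetRing 𝕜 Ω) : IsSmoothFin Ω (rep a) := (exists_rep a).choose_spec.1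

lemma rep_rep (a : JetRing 𝕜 Ω) : Rep (rep a) a := (exists_rep a).choose_spec.2

/-- The element of `𝓕(Ω)` represented by a function on the jet space. -/
def IsSmoothFin.toRing {K : Jet → 𝕜} (hK : IsSmoothFin Ω K) : JetRing 𝕜 Ω :=
  (⟨fun p => K p, K, hK, fun _ => rfl⟩ : ↥(jetSubring 𝕜 Ω))

lemma IsSmoothFin.rep_toRing {K : Jet → 𝕜} (hK : IsSmoothFin Ω K) : Rep K hK.toRing :=
  fun _ => rfl

namespace Rep

variable {K L : Jet → 𝕜} {a b : JetRing 𝕜 Ω}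

lemma eqOn (h : Rep K a) : ∀ p ∈ Ω, K p = rep a p := fun p hp => by
  rw [h ⟨p, hp⟩, rep_rep a ⟨p, hp⟩]

lemma isSmoothFin (h : Rep K a) : IsSmoothFin Ω K := (isSmoothFin_rep a).congr h.eqOn

lemma add (h : Rep K a) (h' : Rep L b) : Rep (K + L) (a + b) := fun p => by
  simp [h p, h' p]

lemma mul (h : Rep K a) (h' : Rep L b) : Rep (K * L) (a * b) := fun p => by
  simp [h p, h' p]

end Rep

/-- A derivation of `𝓕(Ω)` from an operator on functions on the jet space. -/
def derivationOf (X : (Jet → 𝕜) → Jet → 𝕜) (hX : ∀ K, IsSmoothFin Ω K → IsSmoothFin Ω (X K))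
    (congr : ∀ p ∈ Ω, ∀ K L, IsSmoothFin Ω K → (∀ p ∈ Ω, L p = K p) → X L p = X K p)
    (add : ∀ p ∈ Ω, ∀ K L, IsSmoothFin Ω K → IsSmoothFin Ω L → X (K + L) p = X K p + X L p)
    (mul : ∀ p ∈ Ω, ∀ K L, IsSmoothFin Ω K → IsSmoothFin Ω L →
      X (K * L) p = K p * X L p + L p * X K p) : Derivation ℤ (JetRing 𝕜 Ω) (JetRing 𝕜 Ω) :=
  Derivation.mk' (AddMonoidHom.toIntLinearMap
    (AddMonoidHom.mk' (fun a => (hX _ (isSmoothFin_rep a)).toRing) fun a b =>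
      JetRing.ext fun p => by
        rw [← (hX _ (isSmoothFin_rep (a + b))).rep_toRing p, map_add,
          ← (hX _ (isSmoothFin_rep a)).rep_toRing p, ← (hX _ (isSmoothFin_rep b)).rep_toRing p,
          ← add p p.2 _ _ (isSmoothFin_rep a) (isSmoothFin_rep b)]
        exact (congr p p.2 _ _ (isSmoothFin_rep (a + b))
          ((rep_rep a).add (rep_rep b)).eqOn).symm)) fun a b =>
      JetRing.ext fun p => by
        change X (rep (a * b)) p = evAt p a * X (rep b) p + evAt p b * X (rep a) p
        rw [← rep_rep a p, ← rep_rep b p, ← mul p p.2 _ _ (isSmoothFin_rep a) (isSmoothFin_rep b)]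
        exact (congr p p.2 _ _ (isSmoothFin_rep (a * b))
          ((rep_rep a).mul (rep_rep b)).eqOn).symm

variable (hΩ : IsOpen Ω)

/-- The total derivative on `𝓕(Ω)`. -/
def derD : Derivation ℤ (JetRing 𝕜 Ω) (JetRing 𝕜 Ω) :=
  derivationOf totalD (fun _ hK => hK.totalD hΩ)
    (fun _ hp _ _ hK h => IsGivenBy.totalD_congr hΩ hp h hK)
    (fun _ hp _ _ hK hL => hK.totalD_add hΩ hp hL) (fun _ hp _ _ hK hL => hK.totalD_mul hΩ hp hL)

/-- The partial derivative `∂/∂uᵢ` on `𝓕(Ω)`. -/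
def derU (i : ℕ) : Derivation ℤ (JetRing 𝕜 Ω) (JetRing 𝕜 Ω) :=
  derivationOf (partialU i) (fun _ hK => hK.partialU hΩ i)
    (fun _ hp _ _ hK h => IsGivenBy.partialU_congr hΩ hp h hK i)
    (fun _ hp _ _ hK hL => hK.partialU_add hΩ hp hL i)
    (fun _ hp _ _ hK hL => hK.partialU_mul hΩ hp hL i)

namespace Rep

variable {K L : Jet → 𝕜} {a b : JetRing 𝕜 Ω}

lemma totalD (h : Rep K a) : Rep (JetCalculus.totalD K) (derD hΩ a) := fun p =>
  IsGivenBy.totalD_congr hΩ p.2 h.eqOn (isSmoothFin_rep a)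

lemma partialU (h : Rep K a) (i : ℕ) : Rep (JetCalculus.partialU i K) (derU hΩ i a) := fun p =>
  IsGivenBy.partialU_congr hΩ p.2 h.eqOn (isSmoothFin_rep a) i

end Rep

variable (𝕜) in
/-- The differential ring `𝓕(Ω)`. -/
def jetDer : JetDer (JetRing 𝕜 Ω) where
  D := derD hΩ
  d := derU hΩ
  d_comm i j a := JetRing.ext fun p => by
    rw [← ((rep_rep a).partialU hΩ j).partialU hΩ i p, ← ((rep_rep a).partialU hΩ i).partialU hΩ j p]
    exact (isSmoothFin_rep a).partialU_comm hΩ p.2 i j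
  d_zero_D a := JetRing.ext fun p => by
    rw [← ((rep_rep a).totalD hΩ).partialU hΩ 0 p, ← ((rep_rep a).partialU hΩ 0).totalD hΩ p]
    exact (isSmoothFin_rep a).partialU_zero_totalD hΩ p.2
  d_succ_D i a := JetRing.ext fun p => by
    rw [← ((rep_rep a).totalD hΩ).partialU hΩ (i + 1) p, map_add,
      ← ((rep_rep a).partialU hΩ (i + 1)).totalD hΩ p, ← (rep_rep a).partialU hΩ i p]
    exact (isSmoothFin_rep a).partialU_succ_totalD hΩ p.2 i
  finite a := by
    obtain ⟨n, F, hF⟩ := isSmoothFin_rep a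
    refine ⟨n, fun i hi => JetRing.ext fun p => ?_⟩
    rw [← (rep_rep a).partialU hΩ i p, map_zero]
    exact IsGivenBy.partialU_of_le hΩ hF p.2 hi

variable {K L : Jet → 𝕜} {a b : JetRing 𝕜 Ω}

namespace Rep

lemma D (h : Rep K a) : Rep (JetCalculus.totalD K) ((jetDer 𝕜 hΩ).D a) := h.totalD hΩ

lemma d (h : Rep K a) (i : ℕ) : Rep (JetCalculus.partialU i K) ((jetDer 𝕜 hΩ).d i a) :=
  h.partialU hΩ i

lemma T_pow (h : Rep K a) (i : ℕ) :
    Rep (JetCalculus.totalD^[i] K) (((jetDer 𝕜 hΩ).T ^ i) a) := by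
  induction i with
  | zero => exact h
  | succ i ih =>
    rw [Function.iterate_succ_apply', pow_succ', Module.End.mul_apply]
    exact ih.D hΩ

lemma δ (h : Rep K a) : Rep (varDeriv K) ((jetDer 𝕜 hΩ).δ a) := fun p => by
  obtain ⟨n, hn⟩ := (jetDer 𝕜 hΩ).finite a
  rw [JetDer.δ_apply _ hn, map_sum, varDeriv, finsum_eq_sum_of_support_subset (s := range n)]
  · refine sum_congr rfl fun i _ => ?_
    rw [JetDer.E_pow_apply, map_mul, map_pow, map_neg, map_one, (h.d hΩ i).T_pow hΩ i p]
  · intro i hi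
    by_contra hni
    refine hi ?_
    beta_reduce
    rw [(h.d hΩ i).T_pow hΩ i p, hn i (by simpa using hni), map_zero, map_zero, mul_zero]

end Rep

variable (𝕜 Ω) in
/-- The constant `½`. -/
def half : JetRing 𝕜 Ω := (IsSmoothFin.const (1 / 2)).toRing

@[simp] lemma evAt_half (p : Ω) : evAt p (half 𝕜 Ω) = 1 / 2 := rfl

lemma half_add_half : half 𝕜 Ω + half 𝕜 Ω = 1 := JetRing.ext fun p => by
  simp only [map_add, evAt_half, map_one]
  norm_num

lemma Rep.op (h : Rep K a) (h' : Rep L b) :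
    Rep (firstOrderOp K L) ((jetDer 𝕜 hΩ).op (half 𝕜 Ω) a b) := fun p => by
  simp only [firstOrderOp, JetDer.op, Pi.add_apply, Pi.mul_apply, map_add, map_mul, evAt_half,
    h p, h' p, h.D hΩ p, h'.D hΩ p]

lemma Rep.bracket {l k m : JetRing 𝕜 Ω} {M : Jet → 𝕜} (h : Rep K l) (h' : Rep L k) (h'' : Rep M m) :
    Rep (bracket (firstOrderOp K) L M)
      ((jetDer 𝕜 hΩ).δ k * (jetDer 𝕜 hΩ).op (half 𝕜 Ω) l ((jetDer 𝕜 hΩ).δ m)) :=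
  (h'.δ hΩ).mul (h.op hΩ (h''.δ hΩ))

lemma Rep.isNullFunctional_iff (h : Rep K a) :
    IsNullFunctional Ω K ↔ a ∈ (jetDer 𝕜 hΩ).null := by
  constructor
  · rintro ⟨B, hB, hK⟩
    refine ⟨hB.toRing, JetRing.ext fun p => ?_⟩
    rw [JetDer.T_apply, ← hB.rep_toRing.D hΩ p, ← h p, hK p p.2]
  · rintro ⟨b, rfl⟩
    refine ⟨rep b, isSmoothFin_rep b, fun p hp => ?_⟩
    rw [h ⟨p, hp⟩, (rep_rep b).D hΩ ⟨p, hp⟩, JetDer.T_apply]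

lemma isHamiltonian_iff_jacobi {l : JetRing 𝕜 Ω} (h : Rep K l) :
    IsHamiltonian Ω (firstOrderOp K) ↔ (jetDer 𝕜 hΩ).Jacobi (half 𝕜 Ω) l := by
  have hb {P Q p q} (hP : Rep P p) (hQ : Rep Q q) := h.bracket hΩ hP hQ
  constructor
  · rintro ⟨-, hJ⟩ k m n
    refine ((((hb (rep_rep k) (hb (rep_rep m) (rep_rep n))).add
      (hb (rep_rep m) (hb (rep_rep n) (rep_rep k)))).add
      (hb (rep_rep n) (hb (rep_rep k) (rep_rep m)))).isNullFunctional_iff hΩ).1 ?_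
    exact hJ _ _ _ (isSmoothFin_rep _) (isSmoothFin_rep _) (isSmoothFin_rep _)
  · refine fun hJ => ⟨fun P Q hP hQ => ?_, fun P Q R hP hQ hR => ?_⟩
    · refine (((hb hP.rep_toRing hQ.rep_toRing).add
        (hb hQ.rep_toRing hP.rep_toRing)).isNullFunctional_iff hΩ).2 ?_
      -- Skew-symmetry holds for every `l`: the sum is the total derivative of `l` times both
      -- variational derivatives.
      exact JetDer.mul_op_add_mem_null half_add_half _ _ _
    · refine ((((hb hP.rep_toRing (hb hQ.rep_toRing hR.rep_toRing)).add
        (hb hQ.rep_toRing (hb hR.rep_toRing hP.rep_toRing))).add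
        (hb hR.rep_toRing (hb hP.rep_toRing hQ.rep_toRing))).isNullFunctional_iff hΩ).2 ?_
      exact hJ _ _ _

lemma isGivenBy_coord (i : ℕ) :
    IsGivenBy Ω (i + 1) (fun q => ((q.2 (Fin.last i) : ℝ) : 𝕜)) (fun p => ((p.2 i : ℝ) : 𝕜)) :=
  ⟨((RCLike.ofRealCLM (K := 𝕜)).contDiff.comp (f := fun q : ℝ × (Fin (i + 1) → ℝ) =>
    q.2 (Fin.last i)) (by fun_prop)).contDiffOn, fun _ _ => rfl⟩

lemma isGivenBy_x (c : ℝ) :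
    IsGivenBy Ω 0 (fun q => ((q.1 - c : ℝ) : 𝕜)) (fun p => ((p.1 - c : ℝ) : 𝕜)) :=
  ⟨((RCLike.ofRealCLM (K := 𝕜)).contDiff.comp (f := fun q : ℝ × (Fin 0 → ℝ) => q.1 - c)
    (by fun_prop)).contDiffOn, fun _ _ => rfl⟩

variable (𝕜 Ω) in
/-- The coordinate function `uᵢ`. -/
def coordU (i : ℕ) : JetRing 𝕜 Ω := (isGivenBy_coord i).isSmoothFin.toRing

lemma rep_coordU (i : ℕ) : Rep (fun p => ((p.2 i : ℝ) : 𝕜)) (coordU 𝕜 Ω i) :=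
  IsSmoothFin.rep_toRing _

lemma d_coordU (i j : ℕ) :
    (jetDer 𝕜 hΩ).d i (coordU 𝕜 Ω j) = if i = j then 1 else 0 := JetRing.ext fun p => by
  rw [← (rep_coordU j).d hΩ i p, partialU]
  split_ifs with h
  · subst h
    simpa using (RCLike.ofRealCLM (K := 𝕜)).hasDerivAt.deriv
  · simp [Function.update_of_ne (Ne.symm h)]

lemma isPoint_x (p : Ω) : (jetDer 𝕜 hΩ).IsPoint (evAt p)
    (isGivenBy_x (𝕜 := 𝕜) (Ω := Ω) p.1.1).isSmoothFin.toRing where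
  ev_y := by
    rw [← IsSmoothFin.rep_toRing]
    simp
  D_y := JetRing.ext fun q => by
    have h : HasDerivAt (fun t : ℝ => ((t - p.1.1 : ℝ) : 𝕜)) 1 q.1.1 := by
      have h := (RCLike.ofRealCLM (K := 𝕜)).hasFDerivAt.comp_hasDerivAt q.1.1
        ((hasDerivAt_id q.1.1).sub_const p.1.1)
      rw [RCLike.ofRealCLM_apply, RCLike.ofReal_one] at h
      exact h
    rw [← (IsSmoothFin.rep_toRing _).D hΩ q, totalD, partialX, map_one, h.deriv]
    simp [partialU]
  d_y i := JetRing.ext fun q => by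
    rw [← (IsSmoothFin.rep_toRing _).d hΩ i q]
    simp [partialU]

/-- The obstruction to the Jacobi identity for the operator `K D + ½ (D K)`. -/
def obsFun (K : Jet → 𝕜) (p : Jet) : 𝕜 :=
  partialU 1 K p * K p + (1 + 1 / 2) * partialU 2 K p * totalD K p - K p * totalD (partialU 2 K) p

lemma Rep.obs (h : Rep K a) : Rep (obsFun K) ((jetDer 𝕜 hΩ).obs (half 𝕜 Ω) a) := fun p => by
  simp only [obsFun, JetDer.obs, map_add, map_sub, map_mul, map_one, evAt_half, h p, h.D hΩ p,
    h.d hΩ 1 p, h.d hΩ 2 p, (h.d hΩ 2).D hΩ p]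

include hΩ in
lemma IsHamiltonian.obsFun_eq_zero (hK : IsSmoothFin Ω K)
    (h : IsHamiltonian Ω (firstOrderOp K)) :
    ∀ p ∈ Ω, (∀ i ≥ 3, partialU i K p = 0) ∧ obsFun K p = 0 := by
  have hr := hK.rep_toRing
  rw [isHamiltonian_iff_jacobi hΩ hr] at h
  have h0 : (jetDer 𝕜 hΩ).d 0 (coordU 𝕜 Ω 0) = 1 := by simp [d_coordU]
  have h1 : ∀ i, (jetDer 𝕜 hΩ).d (i + 1) (coordU 𝕜 Ω 0) = 0 := by simp [d_coordU]
  have sep : ∀ a : JetRing 𝕜 Ω, (∀ p, evAt p a = 0) → a = 0 := fun a ha =>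
    JetRing.ext fun p => by rw [ha, map_zero]
  intro p hp
  constructor
  · intro i hi
    rw [hr.d hΩ i ⟨p, hp⟩, JetDer.d_eq_zero_of_jacobi (isPoint_x hΩ) sep half_add_half h0 h1 h i hi,
      map_zero]
  · rw [hr.obs hΩ ⟨p, hp⟩,
      JetDer.obs_eq_zero_of_jacobi (isPoint_x hΩ) sep half_add_half h0 h1 h, map_zero]

include hΩ in
-- The conditions are required only off the zeros of `K` and `u₁`; multiplied by `u₁ K` they hold
-- everywhere, and reducedness removes the factor.
lemma isHamiltonian_of_obsFun_eq_zero (hK : IsSmoothFin Ω K)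
    (h : ∀ p ∈ Ω, K p ≠ 0 → p.2 1 ≠ 0 → (∀ i ≥ 3, partialU i K p = 0) ∧ obsFun K p = 0) :
    IsHamiltonian Ω (firstOrderOp K) := by
  have hr := hK.rep_toRing
  have key : ∀ (p : Ω) (c : 𝕜), (K p ≠ 0 → p.1.2 1 ≠ 0 → c = 0) →
      evAt p (coordU 𝕜 Ω 1) * (evAt p hK.toRing * c) = 0 := by
    intro p c hc
    rw [← hr p, ← rep_coordU 1 p]
    by_cases h1 : K p = 0
    · simp [h1]
    · by_cases h2 : p.1.2 1 = 0
      · simp [h2]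
      · simp [hc h1 h2]
  rw [isHamiltonian_iff_jacobi hΩ hr]
  refine JetDer.jacobi_of_mul_eq_zero (v := coordU 𝕜 Ω 1) half_add_half (by simp [d_coordU]) ?_ ?_
  · refine fun i hi => JetRing.ext fun p => ?_
    rw [map_mul, map_mul, map_zero, ← hr.d hΩ i p]
    exact key p _ fun h1 h2 => (h p p.2 h1 h2).1 i hi
  · refine JetRing.ext fun p => ?_
    rw [map_mul, map_mul, map_zero, ← hr.obs hΩ p]
    exact key p _ fun h1 h2 => (h p p.2 h1 h2).2

end

/-! ### The obstruction in terms of `r`, where `l r² = ±1`. -/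

section

namespace JetDer

variable {A : Type*} [CommRing A] {J : JetDer A} {t l r e : A}

lemma d_eq_of_mul_sq {X : Derivation ℤ A A} (he : e * e = 1) (hX : X e = 0) (h : l * r ^ 2 = e) :
    X l = -2 * e * l ^ 2 * r * X r := by
  have h1 := congrArg X h
  simp only [Derivation.leibniz, Derivation.leibniz_pow, smul_eq_mul, nsmul_eq_mul, hX] at h1
  push_cast at h1
  linear_combination (e * l) * h1 - X l * e * h - X l * he

lemma d_eq_zero_of_mul_sq {X : Derivation ℤ A A} (ht : t + t = 1) (he : e * e = 1) (hX : X e = 0)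
    (h : l * r ^ 2 = e) (hl : X l = 0) : X r = 0 := by
  have h1 := congrArg X h
  simp only [Derivation.leibniz, Derivation.leibniz_pow, smul_eq_mul, nsmul_eq_mul, hX, hl] at h1
  push_cast at h1
  linear_combination (t * e * r) * h1 - X r * e * (t + t) * h - X r * (t + t) * he - X r * ht

/-- The terms with `r_2 · D r` occur with coefficients 6, -8 and 2 and cancel; this uses the
coefficient `½` of the operator. -/
lemma obs_eq_of_mul_sq (ht : t + t = 1) (he : e * e = 1) (hD : J.D e = 0) (hd : ∀ i, J.d i e = 0)
    (h : l * r ^ 2 = e) : J.obs t l = 2 * e * l ^ 3 * r * (J.D (J.d 2 r) - J.d 1 r) := by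
  have h1 := d_eq_of_mul_sq he (hd 1) h
  have h2 := d_eq_of_mul_sq he (hd 2) h
  have h3 := d_eq_of_mul_sq he hD h
  have h4 : J.D (J.d 2 l) = -2 * e * (2 * l * J.D l * r * J.d 2 r + l ^ 2 * J.D r * J.d 2 r
      + l ^ 2 * r * J.D (J.d 2 r)) := by
    rw [h2, show (-2 * e * l ^ 2 * r * J.d 2 r) = -(e * l ^ 2 * r * J.d 2 r)
      - (e * l ^ 2 * r * J.d 2 r) by ring]
    simp only [Derivation.leibniz, Derivation.leibniz_pow, smul_eq_mul, nsmul_eq_mul, hD, map_sub,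
      map_neg]
    push_cast
    ring
  rw [obs, h4, h1, h2, h3]
  have h5 : l ^ 4 * r ^ 2 = e * l ^ 3 := by linear_combination l ^ 3 * h
  linear_combination (4 * (1 + t) * e ^ 2 - 8 * e ^ 2) * (J.d 2 r * J.D r) * h5
    + (4 * (1 + t) * e  - 8 * e) * l ^ 3 * (J.d 2 r * J.D r) * he
    + 2 * e * l ^ 3 * (J.d 2 r * J.D r) * ht

lemma D_d_eq_of_obs_eq_zero (ht : t + t = 1) (he : e * e = 1) (hD : J.D e = 0)
    (hd : ∀ i, J.d i e = 0) (h : l * r ^ 2 = e) (hobs : J.obs t l = 0) :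
    J.D (J.d 2 r) = J.d 1 r := by
  rw [obs_eq_of_mul_sq ht he hD hd h] at hobs
  have h1 : l ^ 3 * r ^ 6 = e := by
    rw [show l ^ 3 * r ^ 6 = (l * r ^ 2) ^ 3 by ring, h]
    linear_combination e * he
  linear_combination (t * r ^ 5) * hobs - (J.D (J.d 2 r) - J.d 1 r) * (t + t) * e * h1
    - (J.D (J.d 2 r) - J.d 1 r) * (t + t) * he - (J.D (J.d 2 r) - J.d 1 r) * ht

/-- If `r` depends on `u₀, u₁, u₂` only and `∂₁r = D(∂₂r)`, then `r` is affine in `u₂`. -/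
lemma d_two_d_two_eq_zero (h3 : J.d 3 r = 0) (h : J.D (J.d 2 r) = J.d 1 r) :
    J.d 2 (J.d 2 r) = 0 := by
  -- The commutator of `∂₃` with `D` is `∂₂`, so this extracts the coefficient of `u₃`.
  have h1 := congrArg (J.d 3) h
  rwa [J.d_succ_D, J.d_comm 3 2, J.d_comm 3 1, h3, map_zero, map_zero, map_zero, zero_add] at h1

end JetDer

end

/-! ### Inverse square roots and primitives on convex sets. -/

section

variable {𝕜 : Type*} [RCLike 𝕜] {E : Type*} [NormedAddCommGroup E] [NormedSpace ℝ E]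

/-- Over the reals the sign of `c` remains; over the complex numbers a square root exists and the
sign can be taken to be `+`. -/
lemma exists_mul_sq_eq_sign {c : 𝕜} (hc : c ≠ 0) :
    ∃ e d : 𝕜, (e = 1 ∨ e = -1) ∧ c * d ^ 2 = e := by
  rcases RCLike.I_eq_zero_or_im_I_eq_one (K := 𝕜) with h | h
  · have hre : ((RCLike.re c : ℝ) : 𝕜) = c := by
      conv_rhs => rw [← RCLike.re_add_im c, h, mul_zero, add_zero]
    have hx : RCLike.re c ≠ 0 := fun h0 => hc (by rw [← hre, h0, RCLike.ofReal_zero])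
    rw [← hre]
    generalize RCLike.re c = x at hx
    have key : x * (√|x|)⁻¹ ^ 2 = x / |x| := by
      rw [inv_pow, Real.sq_sqrt (abs_nonneg x), div_eq_mul_inv]
    refine ⟨((x / |x| : ℝ) : 𝕜), (((√|x|)⁻¹ : ℝ) : 𝕜), ?_, by rw [← key]; push_cast; rfl⟩
    rcases hx.lt_or_gt with h0 | h0
    · right
      rw [abs_of_neg h0, div_neg, div_self hx]
      simp
    · left
      rw [abs_of_pos h0, div_self hx]
      simp
  · let φ := RCLike.complexRingEquiv h
    obtain ⟨z, hz⟩ := IsAlgClosed.exists_pow_nat_eq (φ c) (n := 2) two_pos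
    have hz' : φ.symm z ^ 2 = c := by rw [← map_pow, hz, RingEquiv.symm_apply_apply]
    exact ⟨1, (φ.symm z)⁻¹, Or.inl rfl, by rw [inv_pow, hz', mul_inv_cancel₀ hc]⟩

lemma contDiff_exp_rclike : ContDiff ℝ ∞ (NormedSpace.exp : 𝕜 → 𝕜) :=
  contDiff_iff_contDiffAt.2 fun x => (NormedSpace.exp_analytic (𝕂 := ℝ) x).contDiffAt

lemma contDiffOn_of_hasFDerivAt {F : Type*} [NormedAddCommGroup F] [NormedSpace ℝ F] {C : Set E}
    (hC : IsOpen C) {f : E → F} {w : E → E →L[ℝ] F} (hw : ContDiffOn ℝ ∞ w C)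
    (hf : ∀ a ∈ C, HasFDerivAt f (w a) a) : ContDiffOn ℝ ∞ f C :=
  (contDiffOn_infty_iff_fderiv_of_isOpen hC).2
    ⟨fun a ha => (hf a ha).differentiableAt.differentiableWithinAt,
      hw.congr fun a ha => (hf a ha).fderiv⟩

/-- A smooth function without zeros on a convex open set has a smooth logarithm. -/
lemma exists_log {C : Set E} (hC : IsOpen C) (hconv : Convex ℝ C) {G : E → 𝕜}
    (hG : ContDiffOn ℝ ∞ G C) (h0 : ∀ a ∈ C, G a ≠ 0) :
    ∃ f : E → 𝕜, ContDiffOn ℝ ∞ f C ∧ ∀ a ∈ C, HasFDerivAt f ((G a)⁻¹ • fderiv ℝ G a) a := by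
  have hdG : ContDiffOn ℝ ∞ (fderiv ℝ G) C := hG.fderiv_of_isOpen hC (by simp)
  have hw : ContDiffOn ℝ ∞ (fun a => (G a)⁻¹ • fderiv ℝ G a) C := (hG.inv h0).smul hdG
  have hd : ∀ a ∈ C, HasFDerivAt G (fderiv ℝ G a) a := fun a ha =>
    ((hG.contDiffAt (hC.mem_nhds ha)).differentiableAt (by simp)).hasFDerivAt
  have hdd : ∀ a ∈ C, HasFDerivAt (fderiv ℝ G) (fderiv ℝ (fderiv ℝ G) a) a := fun a ha =>
    ((hdG.contDiffAt (hC.mem_nhds ha)).differentiableAt (by simp)).hasFDerivAt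
  obtain ⟨f, hf⟩ := hconv.exists_forall_hasFDerivAt_of_fderiv_symmetric hC (hw.differentiableOn (by simp)) (by
      intro a ha x y
      have hs : fderiv ℝ (fderiv ℝ G) a x y = fderiv ℝ (fderiv ℝ G) a y x :=
        ((hG.contDiffAt (hC.mem_nhds ha)).isSymmSndFDerivAt (by
          rw [minSmoothness_of_isRCLikeNormedField]
          exact WithTop.coe_le_coe.2 (le_top : (2 : ℕ∞) ≤ ⊤))) x y
      have hi := (hasFDerivAt_inv' (𝕜 := ℝ) (h0 a ha)).comp a (hd a ha)
      rw [show (fun a => (G a)⁻¹ • fderiv ℝ G a) =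
        (Inv.inv ∘ G) • fderiv ℝ G from rfl,
        (hi.smul (hdd a ha)).fderiv]
      simp [hs]
      ring)
  exact ⟨f, contDiffOn_of_hasFDerivAt hC hw hf, hf⟩

/-- A smooth function without zeros on a convex open set is, up to a sign, the square of the
inverse of a smooth function. -/
lemma exists_mul_sq_eq {C : Set E} (hC : IsOpen C) (hconv : Convex ℝ C) {G : E → 𝕜}
    (hG : ContDiffOn ℝ ∞ G C) (h0 : ∀ a ∈ C, G a ≠ 0) :
    ∃ (r : E → 𝕜) (e : 𝕜), (e = 1 ∨ e = -1) ∧ ContDiffOn ℝ ∞ r C ∧ ∀ a ∈ C, G a * r a ^ 2 = e := by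
  rcases C.eq_empty_or_nonempty with rfl | ⟨b, hb⟩
  · exact ⟨0, 1, Or.inl rfl, contDiffOn_empty, by simp⟩
  obtain ⟨f, hfs, hf⟩ := exists_log hC hconv hG h0
  let s : E → 𝕜 := fun a => NormedSpace.exp (-(1 / 2 : ℝ) • f a)
  have hs : ContDiffOn ℝ ∞ s C := contDiff_exp_rclike.comp_contDiffOn 
    (hfs.const_smul (-(1 / 2 : ℝ)))
  have hds : ∀ a ∈ C, HasFDerivAt s (s a • (-(1 / 2 : ℝ) • ((G a)⁻¹ • fderiv ℝ G a))) a := by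
    intro a ha
    have h1 := (_root_.hasFDerivAt_exp (𝕂 := ℝ) (x := -(1 / 2 : ℝ) • f a)).comp a
      ((hf a ha).const_smul (-(1 / 2 : ℝ)))
    refine HasFDerivAt.congr_fderiv (f := s) h1 ?_
    ext v
    simp [s]
  -- The logarithmic derivative of `G * s ^ 2` is `dG/G - dG/G = 0`, and `C` is connected. The
  -- constant is then normalised to a sign.
  have hconst : ∀ a ∈ C, G a * s a ^ 2 = G b * s b ^ 2 := by
    intro a ha
    have hd : ∀ a ∈ C, HasFDerivAt (fun a => G a * s a ^ 2) (0 : E →L[ℝ] 𝕜) a := by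
      intro a ha
      have h1 : HasFDerivAt G (fderiv ℝ G a) a :=
        ((hG.contDiffAt (hC.mem_nhds ha)).differentiableAt (by simp)).hasFDerivAt
      have h2 := h1.mul ((hds a ha).mul (hds a ha))
      have h3 : (fun a => G a * s a ^ 2) = G * (s * s) := by
        funext a
        simp [pow_two]
      rw [h3]
      convert h2 using 1
      ext v
      have := h0 a ha
      simp [RCLike.real_smul_eq_coe_mul]
      field_simp
      rw [show algebraMap ℝ 𝕜 2 = 2 from map_ofNat _ 2]
      ring
    exact hC.is_const_of_fderiv_eq_zero hconv.isPreconnected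
      (fun a ha => (hd a ha).differentiableAt.differentiableWithinAt)
      (fun a ha => (hd a ha).fderiv) ha hb
  have hs0 : s b ≠ 0 := by
    intro h
    have := NormedSpace.exp_add (x := -(1 / 2 : ℝ) • f b) (y := (1 / 2 : ℝ) • f b)
    rw [show NormedSpace.exp (-(1 / 2 : ℝ) • f b) = 0 from h, neg_smul, neg_add_cancel,
      NormedSpace.exp_zero, zero_mul] at this
    exact one_ne_zero this
  obtain ⟨e, d, he, hd⟩ := exists_mul_sq_eq_sign (mul_ne_zero (h0 b hb) (pow_ne_zero 2 hs0))
  refine ⟨fun a => d * s a, e, he, contDiffOn_const.mul hs, fun a ha => ?_⟩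
  rw [← hd, ← hconst a ha]
  ring

/-- A closed form `P ds + Q dw` on a convex open subset of the plane has a primitive. -/
lemma exists_primitive {C : Set (ℝ × ℝ)} (hC : IsOpen C) (hconv : Convex ℝ C) {P Q : ℝ × ℝ → 𝕜}
    (hP : ContDiffOn ℝ ∞ P C) (hQ : ContDiffOn ℝ ∞ Q C)
    (h : ∀ a ∈ C, fderiv ℝ P a (0, 1) = fderiv ℝ Q a (1, 0)) :
    ∃ S : ℝ × ℝ → 𝕜, ContDiffOn ℝ ∞ S C ∧ ∀ a ∈ C, HasFDerivAt S
      ((ContinuousLinearMap.fst ℝ ℝ ℝ).smulRight (P a)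
        + (ContinuousLinearMap.snd ℝ ℝ ℝ).smulRight (Q a)) a := by
  let L₁ := ContinuousLinearMap.smulRightL ℝ (ℝ × ℝ) 𝕜 (ContinuousLinearMap.fst ℝ ℝ ℝ)
  let L₂ := ContinuousLinearMap.smulRightL ℝ (ℝ × ℝ) 𝕜 (ContinuousLinearMap.snd ℝ ℝ ℝ)
  have hw : ContDiffOn ℝ ∞ (fun a => L₁ (P a) + L₂ (Q a)) C :=
    (L₁.contDiff.comp_contDiffOn hP).add (L₂.contDiff.comp_contDiffOn hQ)
  obtain ⟨S, hS⟩ := hconv.exists_forall_hasFDerivAt_of_fderiv_symmetric hC (hw.differentiableOn (by simp)) (by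
      intro a ha x y
      have hdP := ((hP.contDiffAt (hC.mem_nhds ha)).differentiableAt (by simp)).hasFDerivAt
      have hdQ := ((hQ.contDiffAt (hC.mem_nhds ha)).differentiableAt (by simp)).hasFDerivAt
      rw [show (fun a => L₁ (P a) + L₂ (Q a)) = L₁ ∘ P + L₂ ∘ Q from rfl,
        ((L₁.hasFDerivAt.comp a hdP).add (L₂.hasFDerivAt.comp a hdQ)).fderiv]
      have hx : ∀ x : ℝ × ℝ, x = x.1 • ((1, 0) : ℝ × ℝ) + x.2 • ((0, 1) : ℝ × ℝ) := fun x => by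
        ext <;> simp
      have e : ∀ (M : ℝ × ℝ →L[ℝ] 𝕜) (x : ℝ × ℝ), M x = x.1 • M (1, 0) + x.2 • M (0, 1) := by
        intro M x
        conv_lhs => rw [hx x]
        rw [map_add, map_smul, map_smul]
      simp only [add_apply, ContinuousLinearMap.comp_apply, L₁, L₂,
        ContinuousLinearMap.smulRightL_apply_apply, ContinuousLinearMap.smulRight_apply,
        ContinuousLinearMap.coe_fst', ContinuousLinearMap.coe_snd']
      rw [e _ x, e (fderiv ℝ Q a) x, e _ y, e (fderiv ℝ Q a) y, h a ha]
      module)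
  exact ⟨S, contDiffOn_of_hasFDerivAt hC hw hS, hS⟩

end

/-! ### Functions of `u₀, u₁` alone, and the sign of `u₁`. -/

section

open Filter Topology

variable {𝕜 : Type*} [RCLike 𝕜] {V : Set (ℕ → ℝ)}

lemma isOpen_jetDomain (hV : IsOpen V) : IsOpen (jetDomain V) := hV.preimage continuous_snd

/-- The set of the values `(u₀, u₁)` over `V`. -/
def plane (V : Set (ℕ → ℝ)) : Set (ℝ × ℝ) := (fun u => (u 0, u 1)) '' V

lemma isOpen_plane (hV : IsOpen V) : IsOpen (plane V) := by
  have h : plane V = (fun q : ℝ × ℝ => ((0 : ℝ), ![q.1, q.2])) ⁻¹' (proj 2 '' jetDomain V) := by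
    ext q
    constructor
    · rintro ⟨u, hu, rfl⟩
      refine ⟨(0, u), hu, ?_⟩
      ext i
      · rfl
      · fin_cases i <;> rfl
    · rintro ⟨p, hp, h⟩
      have h2 := congrArg Prod.snd h
      refine ⟨p.2, hp, Prod.ext (congrFun h2 0) (congrFun h2 1)⟩
  rw [h]
  refine (isOpen_proj_image (isOpen_jetDomain hV) 2).preimage ?_
  refine continuous_const.prodMk (continuous_pi fun i => ?_)
  fin_cases i
  · exact continuous_fst
  · exact continuous_snd

lemma convex_plane (hV : Convex ℝ V) : Convex ℝ (plane V) :=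
  hV.is_linear_image (f := fun u : ℕ → ℝ => (u 0, u 1)) ⟨fun _ _ => rfl, fun _ _ => rfl⟩

/-- The projection onto the coordinates `u₀, u₁`. -/
def coordPlane : ℝ × (Fin 2 → ℝ) →L[ℝ] ℝ × ℝ :=
  ((ContinuousLinearMap.proj 0).prod (ContinuousLinearMap.proj 1)).comp
    (ContinuousLinearMap.snd ℝ ℝ (Fin 2 → ℝ))

section planeFunction

variable {Φ : ℝ × ℝ → 𝕜} (hΦ : ContDiffOn ℝ ∞ Φ (plane V)) {a : (ℕ → ℝ) → 𝕜}
  (ha : ∀ u ∈ V, a u = Φ (u 0, u 1))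
include hΦ ha

lemma isGivenBy_plane : IsGivenBy (jetDomain V) 2 (Φ ∘ coordPlane) (liftU a) := by
  refine ⟨hΦ.comp coordPlane.contDiff.contDiffOn ?_, fun p hp => ha p.2 hp⟩
  rintro _ ⟨p, hp, rfl⟩
  exact ⟨p.2, hp, rfl⟩

variable (hV : IsOpen V) {p : Jet} (hp : p ∈ jetDomain V)
include hV hp

omit ha in
lemma fderiv_comp_coordPlane (v : ℝ × (Fin 2 → ℝ)) :
    fderiv ℝ (Φ ∘ coordPlane) (proj 2 p) v = fderiv ℝ Φ (p.2 0, p.2 1) (v.2 0, v.2 1) := by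
  have h : HasFDerivAt Φ (fderiv ℝ Φ (p.2 0, p.2 1)) (coordPlane (proj 2 p)) :=
    ((hΦ.contDiffAt ((isOpen_plane hV).mem_nhds ⟨p.2, hp, rfl⟩)).differentiableAt
      (by simp)).hasFDerivAt
  rw [(h.comp (proj 2 p) coordPlane.hasFDerivAt).fderiv]
  rfl

lemma partialU_zero_plane : partialU 0 (liftU a) p = fderiv ℝ Φ (p.2 0, p.2 1) (1, 0) := by
  rw [(isGivenBy_plane hΦ ha).partialU_eq (isOpen_jetDomain hV) hp,
    fderiv_comp_coordPlane hΦ hV hp]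
  simp [dirU]

lemma partialU_one_plane : partialU 1 (liftU a) p = fderiv ℝ Φ (p.2 0, p.2 1) (0, 1) := by
  rw [(isGivenBy_plane hΦ ha).partialU_eq (isOpen_jetDomain hV) hp,
    fderiv_comp_coordPlane hΦ hV hp]
  simp [dirU]

lemma totalD_plane : totalD (liftU a) p =
    p.2 1 • partialU 0 (liftU a) p + p.2 2 • partialU 1 (liftU a) p := by
  rw [partialU_zero_plane hΦ ha hV hp, partialU_one_plane hΦ ha hV hp,
    (isGivenBy_plane hΦ ha).totalD_eq (isOpen_jetDomain hV) hp,
    fderiv_comp_coordPlane hΦ hV hp, ← map_smul, ← map_smul, ← map_add]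
  simp [dirD]

lemma partialU_plane_of_two_le {i : ℕ} (hi : 2 ≤ i) : partialU i (liftU a) p = 0 :=
  (isGivenBy_plane hΦ ha).partialU_of_le (isOpen_jetDomain hV) hp hi

end planeFunction

/-- On a convex open set, a function of finitely many coordinates is constant on the fibres over
the first `m` coordinates if its other partial derivatives vanish. -/
lemma eq_of_partialU_eq_zero (hV : IsOpen V) (hconv : Convex ℝ V) {a : (ℕ → ℝ) → 𝕜}
    (ha : IsSmoothFin (jetDomain V) (liftU a)) {m : ℕ}
    (hd : ∀ p ∈ jetDomain V, ∀ i ≥ m, partialU i (liftU a) p = 0) {u w : ℕ → ℝ} (hu : u ∈ V)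
    (hw : w ∈ V) (huw : ∀ i < m, u i = w i) : a u = a w := by
  obtain ⟨n, F, hF⟩ := ha
  have hF : IsGivenBy (jetDomain V) n F (liftU a) := hF
  have hΩ := isOpen_jetDomain hV
  -- The segment from `u` to `w` stays in `V` by convexity and moves only the coordinates from `m`
  -- on. The value of `x` is immaterial.
  let γ : ℝ → Jet := fun t => (0, AffineMap.lineMap u w t)
  have hγ : ∀ t ∈ Set.Icc (0 : ℝ) 1, γ t ∈ jetDomain V := fun t ht => hconv.lineMap_mem hu hw ht
  have hdir : ((0, fun j => w j - u j) : ℝ × (Fin n → ℝ)) =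
      ∑ i ∈ Finset.range n, (w i - u i) • dirU n i := by
    ext j
    · simp [dirU, Prod.fst_sum]
    · simp [dirU, Prod.snd_sum]
  have hder : ∀ t ∈ Set.Icc (0 : ℝ) 1, HasDerivAt (fun t => F (proj n (γ t))) 0 t := by
    intro t ht
    have h1 : HasDerivAt (fun t => proj n (γ t)) (0, fun j => w j - u j) t := by
      refine (hasDerivAt_const _ _).prodMk (hasDerivAt_pi.2 fun j => ?_)
      have : HasDerivAt (fun t : ℝ => AffineMap.lineMap (u j) (w j) t) (w j - u j) t :=
        AffineMap.hasDerivAt_lineMap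
      refine this.congr_of_eventuallyEq (Eventually.of_forall fun s => ?_)
      simp [γ, AffineMap.lineMap_apply]
    have h2 := (hF.hasFDerivAt hΩ (hγ t ht)).comp_hasDerivAt t h1
    suffices h3 : fderiv ℝ F (proj n (γ t)) (0, fun j => w j - u j) = 0 by
      rwa [h3] at h2
    rw [hdir, map_sum, Finset.sum_eq_zero]
    intro i _
    rw [map_smul, ← hF.partialU_eq hΩ (hγ t ht)]
    rcases lt_or_ge i m with hi | hi
    · rw [huw i hi, sub_self, zero_smul]
    · rw [hd _ (hγ t ht) i hi, smul_zero]
  have hc := constant_of_derivWithin_zero (f := fun t => F (proj n (γ t))) (a := 0) (b := 1)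
    (fun t ht => (hder t ht).differentiableAt.differentiableWithinAt)
    (fun t ht => (hder t (Set.Ico_subset_Icc_self ht)).hasDerivWithinAt.derivWithin
      (uniqueDiffOn_Icc one_pos t (Set.Ico_subset_Icc_self ht))) 1 (by simp)
  have h0 := hF.2 (γ 0) (hγ 0 (by simp))
  have h1 := hF.2 (γ 1) (hγ 1 (by simp))
  have e0 : γ 0 = (0, u) := by simp [γ]
  have e1 : γ 1 = (0, w) := by simp [γ]
  have : liftU a (γ 0) = liftU a (γ 1) := by rw [h0, h1]; exact hc.symm
  rwa [e0, e1] at this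

lemma exists_plane_function (hV : IsOpen V) (hconv : Convex ℝ V) {a : (ℕ → ℝ) → 𝕜}
    (ha : IsSmoothFin (jetDomain V) (liftU a))
    (hd : ∀ p ∈ jetDomain V, ∀ i ≥ 2, partialU i (liftU a) p = 0) :
    ∃ Φ : ℝ × ℝ → 𝕜, ContDiffOn ℝ ∞ Φ (plane V) ∧ ∀ u ∈ V, a u = Φ (u 0, u 1) := by
  classical
  let Φ : ℝ × ℝ → 𝕜 := fun q => if h : ∃ u ∈ V, (u 0, u 1) = q then a h.choose else 0
  have hΦ : ∀ u ∈ V, a u = Φ (u 0, u 1) := by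
    intro u hu
    have h : ∃ w ∈ V, (w 0, w 1) = (u 0, u 1) := ⟨u, hu, rfl⟩
    simp only [Φ, dif_pos h]
    refine eq_of_partialU_eq_zero hV hconv ha hd hu h.choose_spec.1 fun i hi => ?_
    have h2 := Prod.ext_iff.1 h.choose_spec.2
    interval_cases i
    exacts [h2.1.symm, h2.2.symm]
  refine ⟨Φ, ?_, hΦ⟩
  rintro _ ⟨u, hu, rfl⟩
  obtain ⟨n, F, hF⟩ := ha
  have hF : IsGivenBy (jetDomain V) n F (liftU a) := hF
  -- A local section through `u`, freezing all coordinates except `u₀, u₁`; near the point `Φ` is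
  -- the smooth function `F` along it.
  let s : ℝ × ℝ → ℕ → ℝ := fun q => Function.update (Function.update u 0 q.1) 1 q.2
  have hs0 : s (u 0, u 1) = u := by simp [s]
  have hscont : Continuous s :=
    ((continuous_const (y := u)).update 0 continuous_fst).update 1 continuous_snd
  have hsV : ∀ᶠ q in 𝓝 (u 0, u 1), s q ∈ V := by
    refine hscont.continuousAt.eventually_mem (hV.mem_nhds ?_)
    rwa [hs0]
  have hsd : ContDiff ℝ ∞ (fun q => proj n ((0, s q) : Jet)) := by
    refine contDiff_const.prodMk (contDiff_pi.2 fun i => ?_)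
    by_cases h1 : (i : ℕ) = 1
    · simpa [s, h1] using contDiff_snd
    · by_cases h0 : (i : ℕ) = 0
      · simpa [s, h0] using contDiff_fst
      · simpa [s, h0, h1] using contDiff_const
  have hFat : ContDiffAt ℝ ∞ F (proj n ((0, s (u 0, u 1)) : Jet)) :=
    hF.contDiffAt (isOpen_jetDomain hV) (by rw [hs0]; exact hu)
  have hcomp := hFat.comp (u 0, u 1) hsd.contDiffAt
  refine (hcomp.congr_of_eventuallyEq ?_).contDiffWithinAt
  filter_upwards [hsV] with q hq
  have h1 := hΦ (s q) hq
  have h2 : liftU a (0, s q) = F (proj n ((0, s q) : Jet)) := hF.2 (0, s q) hq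
  have h3 : (s q 0, s q 1) = q := by simp [s]
  rw [h3] at h1
  rw [← h1]
  exact h2

/-- The sign of `u₁` is constant on a convex set on which `u₁` has no zero. -/
lemma exists_sign (hconv : Convex ℝ V) (h1 : ∀ u ∈ V, u 1 ≠ 0) :
    ∃ σ : ℝ, σ ^ 2 = 1 ∧ ∀ u ∈ V, σ * √(2 * (u 1 ^ 2 / 2)) = u 1 := by
  have key : ∀ u : ℕ → ℝ, √(2 * (u 1 ^ 2 / 2)) = |u 1| := fun u => by
    rw [mul_div_cancel₀ _ two_ne_zero, Real.sqrt_sq_eq_abs]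
  by_cases h : ∃ u ∈ V, 0 < u 1
  · obtain ⟨u, hu, hpos⟩ := h
    refine ⟨1, by norm_num, fun w hw => ?_⟩
    rw [key, one_mul, abs_of_pos]
    by_contra hneg
    have hlt : w 1 < 0 := lt_of_le_of_ne (not_lt.1 hneg) (h1 w hw)
    have himg : Convex ℝ ((fun u : ℕ → ℝ => u 1) '' V) :=
      hconv.is_linear_image ⟨fun _ _ => rfl, fun _ _ => rfl⟩
    obtain ⟨z, hz, hz0⟩ := himg.ordConnected.out ⟨w, hw, rfl⟩ ⟨u, hu, rfl⟩
      (show (0 : ℝ) ∈ Set.Icc (w 1) (u 1) from ⟨hlt.le, hpos.le⟩)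
    exact h1 z hz hz0
  · push Not at h
    refine ⟨-1, by norm_num, fun w hw => ?_⟩
    rw [key, abs_of_nonpos (h w hw)]
    ring

end

/-! ### The potential form implies the vanishing of the obstruction. -/

section

open Filter Topology

variable {𝕜 : Type*} [RCLike 𝕜] {V : Set (ℕ → ℝ)} {a : (ℕ → ℝ) → 𝕜}

lemma IsSmoothFin.mono {Ω Ω' : Set Jet} {K : Jet → 𝕜} (hK : IsSmoothFin Ω K) (h : Ω' ⊆ Ω) :
    IsSmoothFin Ω' K := by
  obtain ⟨n, F, hF, hKF⟩ := hK
  exact ⟨n, F, hF.mono (Set.image_mono h), fun p hp => hKF p (h hp)⟩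

section const

variable {Ω : Set Jet} (hΩ : IsOpen Ω) (c : 𝕜)

lemma D_const : (jetDer 𝕜 hΩ).D (IsSmoothFin.const c).toRing = 0 := JetRing.ext fun p => by
  rw [← (IsSmoothFin.rep_toRing _).D hΩ p, map_zero]
  simp [totalD, partialX, partialU]

lemma d_const (i : ℕ) : (jetDer 𝕜 hΩ).d i (IsSmoothFin.const c).toRing = 0 :=
  JetRing.ext fun p => by
    rw [← (IsSmoothFin.rep_toRing _).d hΩ i p, map_zero]
    simp [partialU]

lemma const_mul_self (hc : c = 1 ∨ c = -1) :
    (IsSmoothFin.const (Ω := Ω) c).toRing * (IsSmoothFin.const c).toRing = 1 :=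
  JetRing.ext fun p => by
    rw [map_mul, ← IsSmoothFin.rep_toRing, map_one]
    rcases hc with rfl | rfl <;> simp

end const

/-- The set of the values `(u₀, u₁² / 2)` over `V`. -/
def energyPlane (V : Set (ℕ → ℝ)) : Set (ℝ × ℝ) := (fun u => (u 0, u 1 ^ 2 / 2)) '' V

/-- Near a point with `u₁ ≠ 0`, the map `(u₀, u₁) ↦ (u₀, u₁²/2)` has the continuous inverse `(u, v)
↦ (u, σ√(2v))`, with `σ` the sign of `u₁` there. -/
lemma isOpen_energyPlane (hV : IsOpen V) (h1 : ∀ u ∈ V, u 1 ≠ 0) : IsOpen (energyPlane V) := by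
  rw [isOpen_iff_mem_nhds]
  rintro _ ⟨u, hu, rfl⟩
  obtain ⟨σ, hσ2, hσ⟩ := exists_sign (convex_singleton u) fun w hw => by
    rw [Set.mem_singleton_iff.1 hw]
    exact h1 u hu
  have hc : Continuous fun q : ℝ × ℝ => (q.1, σ * √(2 * q.2)) := by fun_prop
  have hm : ∀ᶠ q : ℝ × ℝ in 𝓝 (u 0, u 1 ^ 2 / 2), (q.1, σ * √(2 * q.2)) ∈ plane V := by
    refine hc.continuousAt.eventually_mem ((isOpen_plane hV).mem_nhds ⟨u, hu, ?_⟩)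
    rw [hσ u rfl]
  have hpos : ∀ᶠ q : ℝ × ℝ in 𝓝 (u 0, u 1 ^ 2 / 2), 0 < q.2 :=
    continuous_snd.continuousAt.eventually (lt_mem_nhds (by
      have := h1 u hu
      positivity))
  filter_upwards [hm, hpos] with q ⟨w, hw, hwq⟩ hq
  refine ⟨w, hw, Prod.ext (Prod.ext_iff.1 hwq).1 ?_⟩
  have : w 1 = σ * √(2 * q.2) := (Prod.ext_iff.1 hwq).2
  simp only [this, mul_pow, hσ2, Real.sq_sqrt (show 0 ≤ 2 * q.2 by positivity)]
  ring

section potential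

variable {χ : ℝ × ℝ → 𝕜}

/-- The derivative of `χ` in the direction `c`, as a function of `u₀, u₁`. -/
def pull (χ : ℝ × ℝ → 𝕜) (c : ℝ × ℝ) (q : ℝ × ℝ) : 𝕜 := fderiv ℝ χ (q.1, q.2 ^ 2 / 2) c

variable (hV : IsOpen V) (h1 : ∀ u ∈ V, u 1 ≠ 0) (hχ : ContDiffOn ℝ ∞ χ (energyPlane V))
include hV h1 hχ

lemma contDiffOn_pull (c : ℝ × ℝ) : ContDiffOn ℝ ∞ (pull χ c) (plane V) := by
  refine ContDiffOn.clm_apply ((hχ.fderiv_of_isOpen (isOpen_energyPlane hV h1)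
    (m := ∞) (by simp)).comp (ContDiff.contDiffOn (by fun_prop)) ?_) contDiffOn_const
  rintro _ ⟨u, hu, rfl⟩
  exact ⟨u, hu, rfl⟩

variable {u : ℕ → ℝ} (hu : u ∈ V)
include hu

lemma contDiffAt_of_mem : ContDiffAt ℝ ∞ χ (u 0, u 1 ^ 2 / 2) :=
  hχ.contDiffAt ((isOpen_energyPlane hV h1).mem_nhds ⟨u, hu, rfl⟩)

lemma phi_eq_pull : phi χ u = pull χ (0, 1) (u 0, u 1) := by
  have h := ((contDiffAt_of_mem hV h1 hχ hu).differentiableAt (by simp)).hasFDerivAt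
  have hc : HasDerivAt (fun v : ℝ => (u 0, v)) ((0, 1) : ℝ × ℝ) (u 1 ^ 2 / 2) :=
    (hasDerivAt_const _ _).prodMk (hasDerivAt_id _)
  exact (h.comp_hasDerivAt (u 1 ^ 2 / 2) hc).deriv

lemma psi_eq_pull : psi χ u = pull χ (1, 0) (u 0, u 1) := by
  have h := ((contDiffAt_of_mem hV h1 hχ hu).differentiableAt (by simp)).hasFDerivAt
  have hc : HasDerivAt (fun s : ℝ => (s, u 1 ^ 2 / 2)) ((1, 0) : ℝ × ℝ) (u 0) :=
    (hasDerivAt_id _).prodMk (hasDerivAt_const _ _)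
  exact (h.comp_hasDerivAt (u 0) hc).deriv

lemma fderiv_pull (c v : ℝ × ℝ) : fderiv ℝ (pull χ c) (u 0, u 1) v =
    fderiv ℝ (fderiv ℝ χ) (u 0, u 1 ^ 2 / 2) (v.1, u 1 * v.2) c := by
  have h := (((hχ.fderiv_of_isOpen (isOpen_energyPlane hV h1) (m := ∞) (by simp)).contDiffAt
    ((isOpen_energyPlane hV h1).mem_nhds ⟨u, hu, rfl⟩)).differentiableAt (by simp)).hasFDerivAt
  have hm : HasFDerivAt (fun q : ℝ × ℝ => (q.1, q.2 ^ 2 / 2))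
      ((ContinuousLinearMap.fst ℝ ℝ ℝ).prod (u 1 • ContinuousLinearMap.snd ℝ ℝ ℝ)) (u 0, u 1) := by
    have h2 : HasDerivAt (fun t : ℝ => t ^ 2 / 2) (u 1) (u 1) := by
      have := (hasDerivAt_pow 2 (u 1)).div_const 2
      simpa using this
    exact hasFDerivAt_fst.prodMk
      (h2.comp_hasFDerivAt (f := fun q : ℝ × ℝ => q.2) (u 0, u 1) hasFDerivAt_snd)
  have h3 := (h.comp (f := fun q : ℝ × ℝ => (q.1, q.2 ^ 2 / 2)) (u 0, u 1) hm).clm_apply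
    (hasFDerivAt_const c _)
  have h4 : pull χ c = fun q => (fderiv ℝ χ ∘ fun q : ℝ × ℝ => (q.1, q.2 ^ 2 / 2)) q c := rfl
  rw [h4, h3.fderiv]
  simp

/-- Both sides are `u₁ χ_uv`: the factor `u₁` on the left is the chain rule for `v = u₁²/2`. -/
lemma fderiv_pull_comm : fderiv ℝ (pull χ (1, 0)) (u 0, u 1) (0, 1) =
    u 1 • fderiv ℝ (pull χ (0, 1)) (u 0, u 1) (1, 0) := by
  rw [fderiv_pull hV h1 hχ hu, fderiv_pull hV h1 hχ hu]
  have hs := ((contDiffAt_of_mem hV h1 hχ hu).isSymmSndFDerivAt (by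
    rw [minSmoothness_of_isRCLikeNormedField]
    exact WithTop.coe_le_coe.2 (le_top : (2 : ℕ∞) ≤ ⊤))) (0, u 1) (1, 0)
  have e : ((0, u 1) : ℝ × ℝ) = u 1 • (0, 1) := by simp
  simp only [mul_one, mul_zero]
  rw [hs, e, map_smul]

end potential

lemma HasPotentialForm.obsFun_eq_zero (hV : IsOpen V) (h1 : ∀ u ∈ V, u 1 ≠ 0)
    (ha : IsSmoothFin (jetDomain V) (liftU a)) (h : HasPotentialForm V a) :
    ∀ p ∈ jetDomain V, (∀ i ≥ 3, partialU i (liftU a) p = 0) ∧ obsFun (liftU a) p = 0 := by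
  obtain ⟨χ, ε, hε, hχ, hform⟩ := h
  have hχ : ContDiffOn ℝ ∞ χ (energyPlane V) := hχ
  have hΩ := isOpen_jetDomain hV
  have hΦ := contDiffOn_pull hV h1 hχ (0, 1)
  have hΨ := contDiffOn_pull hV h1 hχ (1, 0)
  have hφ : ∀ u ∈ V, phi χ u = pull χ (0, 1) (u 0, u 1) := fun u hu => phi_eq_pull hV h1 hχ hu
  have hψ : ∀ u ∈ V, psi χ u = pull χ (1, 0) (u 0, u 1) := fun u hu => psi_eq_pull hV h1 hχ hu
  have hφs := (isGivenBy_plane hΦ hφ).isSmoothFin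
  have hψs := (isGivenBy_plane hΨ hψ).isSmoothFin
  let J := jetDer 𝕜 hΩ
  let l := ha.toRing
  let f := hφs.toRing
  let g := hψs.toRing
  let e := (IsSmoothFin.const (Ω := jetDomain V) ε).toRing
  let r := f * coordU 𝕜 _ 2 + g
  have he : e * e = 1 := const_mul_self ε hε
  have hl : l * r ^ 2 = e := JetRing.ext fun p => by
    have h2 := hform p.1.2 p.2
    simp only [l, r, f, g, e, map_mul, map_add, map_pow, ← IsSmoothFin.rep_toRing _ p,
      ← rep_coordU 2 p, liftU, h2.2]
    rw [mul_assoc, zpow_neg, zpow_ofNat, inv_mul_cancel₀ (pow_ne_zero 2 h2.1), mul_one]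
  have hf : ∀ i ≥ 2, J.d i f = 0 := fun i hi => JetRing.ext fun p => by
    rw [← (IsSmoothFin.rep_toRing _).d hΩ i p, map_zero]
    exact partialU_plane_of_two_le hΦ hφ hV p.2 hi
  have hg : ∀ i ≥ 2, J.d i g = 0 := fun i hi => JetRing.ext fun p => by
    rw [← (IsSmoothFin.rep_toRing _).d hΩ i p, map_zero]
    exact partialU_plane_of_two_le hΨ hψ hV p.2 hi
  have hr3 : ∀ i ≥ 3, J.d i r = 0 := fun i hi => by
    simp [r, J, Derivation.leibniz, d_coordU, hf i (by omega), hg i (by omega),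
      (show i ≠ 2 by omega)]
  have hr2 : J.d 2 r = f := by
    have := hf 2 le_rfl
    have := hg 2 le_rfl
    simp_all [r, J, Derivation.leibniz, d_coordU]
  have hr1 : J.d 1 r = J.d 1 f * coordU 𝕜 _ 2 + J.d 1 g := by
    simp [r, J, Derivation.leibniz, d_coordU, mul_comm]
  -- As `φ` depends on `u₀, u₁` only, `Dφ = u₁ ∂₀φ + u₂ ∂₁φ`, and the first summand is `∂₁ψ` by
  -- `fderiv_pull_comm`.
  have hD : J.D (J.d 2 r) = J.d 1 r := by
    rw [hr2, hr1]
    refine JetRing.ext fun p => ?_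
    rw [map_add, map_mul, ← (IsSmoothFin.rep_toRing hφs).D hΩ p,
      ← (IsSmoothFin.rep_toRing hφs).d hΩ 1 p, ← (IsSmoothFin.rep_toRing hψs).d hΩ 1 p,
      ← rep_coordU 2 p]
    have e1 := totalD_plane hΦ hφ hV p.2
    have e2 := partialU_one_plane hΨ hψ hV p.2
    rw [fderiv_pull_comm hV h1 hχ p.2, ← partialU_zero_plane hΦ hφ hV p.2] at e2
    rw [e1, e2, RCLike.real_smul_eq_coe_mul, RCLike.real_smul_eq_coe_mul]
    ring
  intro p hp
  constructor
  · intro i hi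
    rw [ha.rep_toRing.d hΩ i ⟨p, hp⟩, JetDer.d_eq_of_mul_sq he (d_const hΩ ε i) hl]
    have := hr3 i hi
    simp only [J] at this
    rw [this, mul_zero, map_zero]
  · rw [ha.rep_toRing.obs hΩ ⟨p, hp⟩,
      JetDer.obs_eq_of_mul_sq half_add_half he (D_const hΩ ε) (d_const hΩ ε) hl]
    simp only [J] at hD
    rw [hD, sub_self, mul_zero, map_zero]

end

/-! ### The vanishing of the obstruction implies the potential form. -/

section

open Filter Topology

variable {𝕜 : Type*} [RCLike 𝕜] {V : Set (ℕ → ℝ)} {a : (ℕ → ℝ) → 𝕜}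

/-- Up to the sign, `a` is the inverse square of a function of finitely many coordinates. -/
lemma exists_mul_sq_eq_of_isSmoothFin (hV : IsOpen V) (hconv : Convex ℝ V)
    (ha : IsSmoothFin (jetDomain V) (liftU a)) (h0 : ∀ u ∈ V, a u ≠ 0) :
    ∃ (ρ : (ℕ → ℝ) → 𝕜) (e : 𝕜), (e = 1 ∨ e = -1) ∧ IsSmoothFin (jetDomain V) (liftU ρ) ∧
      ∀ u ∈ V, a u * ρ u ^ 2 = e := by
  obtain ⟨n, F, hF, hFa⟩ := ha
  have hC : Convex ℝ (proj n '' jetDomain V) :=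
    Convex.is_linear_image (hconv.is_linear_preimage (f := fun p : Jet => p.2)
      ⟨fun _ _ => rfl, fun _ _ => rfl⟩) ⟨fun _ _ => rfl, fun _ _ => rfl⟩
  obtain ⟨r, e, he, hr, hre⟩ := exists_mul_sq_eq (isOpen_proj_image (isOpen_jetDomain hV) n) hC hF
    (by
      rintro _ ⟨p, hp, rfl⟩
      rw [← hFa p hp]
      exact h0 p.2 hp)
  -- The root may depend on `x` although `a` does not; freezing `x = 0` removes the dependence.
  refine ⟨fun u => r (proj n (0, u)), e, he, ⟨n, fun q => r (0, q.2), ?_, fun p _ => rfl⟩, ?_⟩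
  · refine hr.comp (ContDiff.contDiffOn (by fun_prop)) ?_
    rintro _ ⟨p, hp, rfl⟩
    exact ⟨(0, p.2), hp, rfl⟩
  · intro u hu
    have h1 : a u = F (proj n (0, u)) := hFa (0, u) hu
    rw [h1]
    exact hre _ ⟨(0, u), hu, rfl⟩

/-- If `φ = Φ(u₀, u₁)` and `ψ = Ψ(u₀, u₁)` satisfy `∂ψ/∂u₁ = u₁ ∂φ/∂u₀` then they come from a
potential. -/
lemma exists_potential (hV : IsOpen V) (hconv : Convex ℝ V) (h1 : ∀ u ∈ V, u 1 ≠ 0)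
    {Φ Ψ : ℝ × ℝ → 𝕜} (hΦ : ContDiffOn ℝ ∞ Φ (plane V)) (hΨ : ContDiffOn ℝ ∞ Ψ (plane V))
    (h : ∀ u ∈ V, fderiv ℝ Ψ (u 0, u 1) (0, 1) = u 1 • fderiv ℝ Φ (u 0, u 1) (1, 0)) :
    ∃ χ : ℝ × ℝ → 𝕜, ContDiffOn ℝ ∞ χ (energyPlane V) ∧
      ∀ u ∈ V, phi χ u = Φ (u 0, u 1) ∧ psi χ u = Ψ (u 0, u 1) := by
  -- The primitive is taken in the coordinates `(u₀, u₁)`, whose range is convex as a linear image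
  -- of `V`; the range of `(u₀, u₁²/2)` need not be convex.
  have hQ : ContDiffOn ℝ ∞ (fun q : ℝ × ℝ => q.2 • Φ q) (plane V) := contDiffOn_snd.smul hΦ
  obtain ⟨S, hS, hdS⟩ := exists_primitive (isOpen_plane hV) (convex_plane hconv) hΨ hQ (by
    rintro _ ⟨u, hu, rfl⟩
    have hd : HasFDerivAt Φ (fderiv ℝ Φ (u 0, u 1)) (u 0, u 1) :=
      ((hΦ.contDiffAt ((isOpen_plane hV).mem_nhds ⟨u, hu, rfl⟩)).differentiableAt
        (by simp)).hasFDerivAt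
    have h2 := (hasFDerivAt_snd (𝕜 := ℝ) (p := (u 0, u 1))).smul hd
    rw [show (fun q : ℝ × ℝ => q.2 • Φ q) = (Prod.snd : ℝ × ℝ → ℝ) • Φ from rfl, h2.fderiv]
    simp [h u hu])
  obtain ⟨σ, hσ2, hσ⟩ := exists_sign hconv h1
  refine ⟨fun q => S (q.1, σ * √(2 * q.2)), ?_, fun u hu => ?_⟩
  · refine hS.comp (t := plane V) (f := fun q : ℝ × ℝ => (q.1, σ * √(2 * q.2))) ?_ ?_
    · refine contDiffOn_fst.prodMk (contDiffOn_const.mul (ContDiffOn.sqrt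
        (contDiffOn_const.mul contDiffOn_snd) ?_))
      rintro _ ⟨u, hu, rfl⟩
      have := h1 u hu
      positivity
    · rintro _ ⟨u, hu, rfl⟩
      exact ⟨u, hu, by simp only [hσ u hu]⟩
  · have hu1 := h1 u hu
    have hd := hdS (u 0, u 1) ⟨u, hu, rfl⟩
    have e : (u 0, σ * √(2 * (u 1 ^ 2 / 2))) = (u 0, u 1) := by rw [hσ u hu]
    constructor
    · have hpos : 2 * (u 1 ^ 2 / 2) ≠ 0 := by positivity
      have hs : HasDerivAt (fun v : ℝ => σ * √(2 * v)) (1 / u 1) (u 1 ^ 2 / 2) := by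
        have h4 : HasDerivAt (fun v : ℝ => 2 * v) 2 (u 1 ^ 2 / 2) := by
          simpa using (hasDerivAt_id' (u 1 ^ 2 / 2)).const_mul (2 : ℝ)
        have h2 := (h4.sqrt hpos).const_mul σ
        refine h2.congr_deriv ?_
        have h3 : √(2 * (u 1 ^ 2 / 2)) = σ * u 1 := by
          linear_combination (-√(2 * (u 1 ^ 2 / 2))) * hσ2 + σ * hσ u hu
        have hσ0 : σ ≠ 0 := fun h0 => by simp [h0] at hσ2
        rw [h3]
        field_simp
      have hc : HasDerivAt (fun v : ℝ => (u 0, σ * √(2 * v))) ((0, 1 / u 1) : ℝ × ℝ)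
          (u 1 ^ 2 / 2) := (hasDerivAt_const _ _).prodMk hs
      rw [← e] at hd
      have h3 := (hd.comp_hasDerivAt (u 1 ^ 2 / 2) hc).deriv
      rw [e] at h3
      refine Eq.trans h3 ?_
      simp [smul_smul, hu1]
    · have hc : HasDerivAt (fun s : ℝ => (s, σ * √(2 * (u 1 ^ 2 / 2)))) ((1, 0) : ℝ × ℝ) (u 0) :=
        (hasDerivAt_id _).prodMk (hasDerivAt_const _ _)
      rw [← e] at hd
      have h3 := (hd.comp_hasDerivAt (u 0) hc).deriv
      rw [e] at h3
      refine Eq.trans h3 ?_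
      simp

lemma hasPotentialForm_of_obsFun_eq_zero (hV : IsOpen V) (hconv : Convex ℝ V)
    (ha : IsSmoothFin (jetDomain V) (liftU a)) (h0 : ∀ u ∈ V, a u ≠ 0) (h1 : ∀ u ∈ V, u 1 ≠ 0)
    (h : ∀ p ∈ jetDomain V, (∀ i ≥ 3, partialU i (liftU a) p = 0) ∧ obsFun (liftU a) p = 0) :
    HasPotentialForm V a := by
  obtain ⟨ρ, ε, hε, hρ, hρa⟩ := exists_mul_sq_eq_of_isSmoothFin hV hconv ha h0
  have hΩ := isOpen_jetDomain hV
  let J := jetDer 𝕜 hΩ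
  let l := ha.toRing
  let r := hρ.toRing
  let e := (IsSmoothFin.const (Ω := jetDomain V) ε).toRing
  have he : e * e = 1 := const_mul_self ε hε
  have hl : l * r ^ 2 = e := JetRing.ext fun p => by
    simp only [l, r, e, map_mul, map_pow, ← IsSmoothFin.rep_toRing _ p, liftU, hρa p.1.2 p.2]
  have hD : J.D (J.d 2 r) = J.d 1 r :=
    JetDer.D_d_eq_of_obs_eq_zero half_add_half he (D_const hΩ ε) (d_const hΩ ε) hl
      (JetRing.ext fun p => by rw [← ha.rep_toRing.obs hΩ p, (h p p.2).2, map_zero])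
  have hr : ∀ i ≥ 3, J.d i r = 0 := fun i hi =>
    JetDer.d_eq_zero_of_mul_sq half_add_half he (d_const hΩ ε i) hl
      (JetRing.ext fun p => by
        rw [map_zero, ← (h p p.2).1 i hi]
        exact (ha.rep_toRing.d hΩ i p).symm)
  -- This is `∂ρ/∂u₂` written without `x`, so that its lift is `partialU 2 (liftU ρ)` by definition.
  let φ : (ℕ → ℝ) → 𝕜 := fun u => deriv (fun s => ρ (Function.update u 2 s)) (u 2)
  let ψ : (ℕ → ℝ) → 𝕜 := fun u => ρ u - ((u 2 : ℝ) : 𝕜) * φ u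
  let g := r - coordU 𝕜 _ 2 * J.d 2 r
  have hφr : Rep (liftU φ) (J.d 2 r) := hρ.rep_toRing.d hΩ 2
  have hψr : Rep (liftU ψ) g := fun p => by
    simp only [g, map_sub, map_mul, ← hφr p, ← rep_coordU 2 p, r, ← hρ.rep_toRing p]
    rfl
  have hφ2 : ∀ i ≥ 2, J.d i (J.d 2 r) = 0 := fun i hi => by
    rcases hi.eq_or_lt with rfl | hi
    · exact JetDer.d_two_d_two_eq_zero (hr 3 le_rfl) hD
    · rw [J.d_comm, hr i hi, map_zero]
  have hψ2 : ∀ i ≥ 2, J.d i g = 0 := fun i hi => by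
    have h2 := hφ2 i hi
    rcases hi.eq_or_lt with rfl | hi
    · simp_all [g, J, Derivation.leibniz, d_coordU]
    · have h3 := hr i hi
      simp_all [g, J, Derivation.leibniz, d_coordU, (show i ≠ 2 by omega)]
  obtain ⟨Φ, hΦ, hφΦ⟩ := exists_plane_function hV hconv hφr.isSmoothFin fun p hp i hi => by
    rw [hφr.d hΩ i ⟨p, hp⟩]
    exact (congrArg _ (hφ2 i hi)).trans (map_zero _)
  obtain ⟨Ψ, hΨ, hψΨ⟩ := exists_plane_function hV hconv hψr.isSmoothFin fun p hp i hi => by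
    rw [hψr.d hΩ i ⟨p, hp⟩]
    exact (congrArg _ (hψ2 i hi)).trans (map_zero _)
  have hclosed : ∀ u ∈ V, fderiv ℝ Ψ (u 0, u 1) (0, 1) =
      u 1 • fderiv ℝ Φ (u 0, u 1) (1, 0) := by
    intro u hu
    have hp : ((0, u) : Jet) ∈ jetDomain V := hu
    rw [← partialU_one_plane hΨ hψΨ hV hp, ← partialU_zero_plane hΦ hφΦ hV hp]
    have e1 := totalD_plane hΦ hφΦ hV hp
    -- Since `∂₁r = D(∂₂r)`, subtracting `u₂ ∂₁φ` from `Dφ` leaves `u₁ ∂₀φ`.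
    have e2 : J.d 1 g = J.D (J.d 2 r) - coordU 𝕜 _ 2 * J.d 1 (J.d 2 r) := by
      rw [hD]
      simp [g, J, Derivation.leibniz, d_coordU]
    have e3 := congrArg (evAt ⟨(0, u), hp⟩) e2
    rw [map_sub (evAt _), map_mul (evAt _), ← hψr.d hΩ 1 ⟨(0, u), hp⟩, ← hφr.D hΩ ⟨(0, u), hp⟩,
      ← hφr.d hΩ 1 ⟨(0, u), hp⟩, ← rep_coordU 2 ⟨(0, u), hp⟩] at e3
    rw [e3, e1, RCLike.real_smul_eq_coe_mul, RCLike.real_smul_eq_coe_mul]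
    ring
  obtain ⟨χ, hχ, hχΦ⟩ := exists_potential hV hconv h1 hΦ hΨ hclosed
  refine ⟨χ, ε, hε, hχ, fun u hu => ?_⟩
  have e1 : phi χ u * ((u 2 : ℝ) : 𝕜) + psi χ u = ρ u := by
    rw [(hχΦ u hu).1, (hχΦ u hu).2, ← hφΦ u hu, ← hψΨ u hu]
    simp only [ψ]
    ring
  have hρ0 : ρ u ≠ 0 := by
    intro h2
    have h3 := hρa u hu
    rw [h2] at h3
    rcases hε with rfl | rfl <;> simp at h3
  rw [e1]
  refine ⟨hρ0, ?_⟩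
  rw [← hρa u hu, zpow_neg, zpow_ofNat, mul_assoc, mul_inv_cancel₀ (pow_ne_zero 2 hρ0), mul_one]

/-- The product topology is locally convex and `a` is continuous on `U`, so the hypothesis on convex
sets can be applied around any point where `a` and `u₁` do not vanish. -/
lemma exists_convex_nhd {U : Set (ℕ → ℝ)} (hU : IsOpen U)
    (ha : IsSmoothFin (jetDomain U) (liftU a)) {u : ℕ → ℝ} (hu : u ∈ U) (h0 : a u ≠ 0)
    (h1 : u 1 ≠ 0) : ∃ V ⊆ U, u ∈ V ∧ IsOpen V ∧ Convex ℝ V ∧ ∀ w ∈ V, a w ≠ 0 ∧ w 1 ≠ 0 := by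
  obtain ⟨n, F, hF⟩ := ha
  have hF : IsGivenBy (jetDomain U) n F (liftU a) := hF
  have hp : ((0, u) : Jet) ∈ jetDomain U := hu
  have hc : ContinuousAt (liftU a) ((0, u) : Jet) :=
    ((hF.contDiffAt (isOpen_jetDomain hU) hp).continuousAt.comp
      (continuous_proj n).continuousAt).congr (hF.eventuallyEq (isOpen_jetDomain hU) hp).symm
  have hca : ContinuousAt a u :=
    ContinuousAt.comp (g := liftU a) (f := fun w : ℕ → ℝ => ((0, w) : Jet)) hc
      (by fun_prop : Continuous fun w : ℕ → ℝ => ((0, w) : Jet)).continuousAt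
  have hN : {w | w ∈ U ∧ a w ≠ 0 ∧ w 1 ≠ 0} ∈ 𝓝 u :=
    Filter.inter_mem (hU.mem_nhds hu) (Filter.inter_mem (hca.eventually_ne h0)
      ((continuous_apply (A := fun _ : ℕ => ℝ) 1).continuousAt.eventually_ne h1))
  obtain ⟨s, ⟨hs, hconv⟩, hsub⟩ := (LocallyConvexSpace.convex_basis (𝕜 := ℝ) u).mem_iff.1 hN
  exact ⟨interior s, fun w hw => (hsub (interior_subset hw)).1, mem_interior_iff_mem_nhds.2 hs,
    isOpen_interior, hconv.interior, fun w hw => (hsub (interior_subset hw)).2⟩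

end

end JetCalculus

end

theorem mainTheorem3 {𝕜 : Type*} [RCLike 𝕜] (U : Set (ℕ → ℝ)) (hU : IsOpen U)
    (lam : (ℕ → ℝ) → 𝕜)
    (hlam : JetCalculus.IsSmoothFin (JetCalculus.jetDomain U) (JetCalculus.liftU lam)) :
    JetCalculus.IsHamiltonian (JetCalculus.jetDomain U)
        (JetCalculus.firstOrderOp (JetCalculus.liftU lam)) ↔
      ∀ V : Set (ℕ → ℝ), V ⊆ U → IsOpen V → Convex ℝ V →
        (∀ u ∈ V, lam u ≠ 0 ∧ u 1 ≠ 0) → JetCalculus.HasPotentialForm V lam := by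
  constructor
  · intro hH V hVU hV hconv hne
    have h := hH.obsFun_eq_zero (JetCalculus.isOpen_jetDomain hU) hlam
    exact JetCalculus.hasPotentialForm_of_obsFun_eq_zero hV hconv
      (hlam.mono fun _ hp => hVU hp) (fun u hu => (hne u hu).1) (fun u hu => (hne u hu).2)
      fun p hp => h p (hVU hp)
  · intro h
    -- The obstruction is local, so it is enough to have the potential form on a small convex
    -- neighbourhood of each point with `lam ≠ 0` and `u₁ ≠ 0`.
    refine JetCalculus.isHamiltonian_of_obsFun_eq_zero (JetCalculus.isOpen_jetDomain hU) hlam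
      fun p hp h0 h1 => ?_
    obtain ⟨V, hVU, hpV, hV, hconv, hne⟩ := JetCalculus.exists_convex_nhd hU hlam hp h0 h1
    exact (h V hVU hV hconv hne).obsFun_eq_zero hV (fun u hu => (hne u hu).2)
      (hlam.mono fun _ hq => hVU hq) p hpV
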